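/- Let $(\mathcal A,[\cdot,\cdot]_{\mathcal A},\rho)$ be a transitive Lie algebroid over a connected smooth manifold $M$: $\mathcal A\to M$ is a smooth real vector bundle, $\rho:\mathcal A\to TM$ is a fibrewise surjective smooth bundle map, and $[\cdot,\cdot]_{\mathcal A}$ is a real Lie bracket on $\Gamma(\mathcal A)$ such that $\rho:\Gamma(\mathcal A)\to\mathfrak X(M)$ is a Lie algebra morphism and $[A,fB]_{\mathcal A}=f[A,B]_{\mathcal A}+(\rho(A)f)B$. Let $\mathfrak L:\mathcal A\to\mathcal{CDO}(F)$ be a representation of $\mathcal A$ on a smooth real vector bundle $F\to M$: a smooth bundle map into the covariant differential operators of $F$ with $\mathfrak L_A(f\mu)=(\rho(A)f)\mu+f\,\mathfrak L_A\mu$ and $\mathfrak L_{[A,B]}=\mathfrak L_A\mathfrak L_B-\mathfrak L_B\mathfrak L_A$. For $y\in M$ let $L_y=\operatorname{Ker}\rho_y$, a Lie algebra which acts on $F_y$ through $\mathfrak L$, and let $F_{0y}=\{\nu\in F_y:\mathfrak L_u\nu=0\ \forall u\in L_y\}$. The $F_{0y}$ form an $\mathfrak L$-invariant subbundle $F_0\subset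 F$. For $G=F$ or $G=F_0$ put $H^1(\mathcal A,G)=D^1(\mathcal A,G)/B^1(\mathcal A,G)$, where $D^1(\mathcal A,G)$ is the space of smooth bundle maps $\Omega:\mathcal A\to G$ with $\Omega([A,B]_{\mathcal A})=\mathfrak L_A(\Omega(B))-\mathfrak L_B(\Omega(A))$ for all $A,B\in\Gamma(\mathcal A)$, and $B^1(\mathcal A,G)$ is the space of maps $A\mapsto\mathfrak L_A\mu$ with $\mu\in\Gamma(G)$. For a Lie algebra $\mathfrak g$ and a $\mathfrak g$-module $W$ let $H^1(\mathfrak g,W)=D^1(\mathfrak g,W)/B^1(\mathfrak g,W)$ be the first Chevalley cohomology (cocycles modulo coboundaries). Fix $x\in M$, and let $$\Upsilon^1_x:H^1(\mathcal A,F)\to H^1(L_x,F_x),\qquad \Upsilon^1_{0x}:H^1(\mathcal A,F_0)\to H^1(L_x,F_{0x})$$ be the localization maps $[\Omega]\mapsto[\Omega|_{L_x}]$, and $i_*:H^1(\mathcal A,F_0)\to H^1(\mathcal A,F)$ the map induced by the inclusion $F_0\subset F$. **Theorem.** 1. $L_x$ acts trivially on $F_{0x}$, and $H^1(L_x,F_{0x})=D^1(L_x,F_{0x})$,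 i.e. the projection $D^1(L_x,F_{0x})\to H^1(L_x,F_{0x})$ is bijective. 2. The map $i_*$ restricts to a linear isomorphism $\operatorname{Ker}\Upsilon^1_{0x}\cong\operatorname{Ker}\Upsilon^1_x$. 3. $\operatorname{Ker}\Upsilon^1_{0x}=\{[\Omega]:\Omega\in D^1(\mathcal A,F_0),\ \Omega|_{L_x}=0\}$. -/

import Mathlib

set_option linter.unusedSectionVars false

open scoped Manifold ContDiff Bundle
open Bundle

noncomputable section

/-! ### Smooth sections of a vector bundle -/

section Sections

variable {E : Type*} [NormedAddCommGroup E] [NormedSpace ℝ E]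
  {M : Type*} [TopologicalSpace M] [ChartedSpace E M]
  {FV : Type*} [NormedAddCommGroup FV] [NormedSpace ℝ FV]
  {V : M → Type*} [TopologicalSpace (TotalSpace FV V)]
  [∀ x, AddCommGroup (V x)] [∀ x, Module ℝ (V x)] [∀ x, TopologicalSpace (V x)]
  [FiberBundle FV V] [VectorBundle ℝ FV V]

/-- `Γ(V)`: the real vector space of smooth global sections of the vector bundle `V → M` with
model fibre `FV`, over a manifold modelled on `E`. -/
abbrev SmoothSection (E : Type*) [NormedAddCommGroup E] [NormedSpace ℝ E]
    {M : Type*} [TopologicalSpace M] [ChartedSpace E M]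
    (FV : Type*) [NormedAddCommGroup FV] [NormedSpace ℝ FV]
    (V : M → Type*) [TopologicalSpace (TotalSpace FV V)]
    [∀ x, TopologicalSpace (V x)] [FiberBundle FV V] : Type _ :=
  ContMDiffSection 𝓘(ℝ, E) FV ∞ V

/-- The product `f s` of a smooth function and a smooth section. -/
def SmoothSection.fmul (f : C^∞⟮𝓘(ℝ, E), M; ℝ⟯) (s : SmoothSection E FV V) :
    SmoothSection E FV V :=
  ⟨fun x => f x • s x, f.contMDiff.smul_section s.contMDiff⟩

@[simp] theorem SmoothSection.fmul_apply (f : C^∞⟮𝓘(ℝ, E), M; ℝ⟯) (s : SmoothSection E FV V)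
    (x : M) : SmoothSection.fmul f s x = f x • s x := rfl

/-- The derivative `X(f)` of a smooth function along a tangent vector `X ∈ T_x M`. -/
def dirDeriv (f : C^∞⟮𝓘(ℝ, E), M; ℝ⟯) {x : M} (X : TangentSpace 𝓘(ℝ, E) x) : ℝ :=
  mfderiv 𝓘(ℝ, E) 𝓘(ℝ, ℝ) f x X

@[simp] theorem dirDeriv_zero (f : C^∞⟮𝓘(ℝ, E), M; ℝ⟯) (x : M) :
    dirDeriv f (0 : TangentSpace 𝓘(ℝ, E) x) = 0 :=
  map_zero (mfderiv 𝓘(ℝ, E) 𝓘(ℝ, ℝ) f x)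

variable [FiniteDimensional ℝ E] [T2Space M] [IsManifold 𝓘(ℝ, E) ∞ M]

/-- Smooth cut-off functions. -/
theorem exists_smooth_cutoff {u : Set M} {x : M} (hu : u ∈ nhds x) :
    ∃ ψ : C^∞⟮𝓘(ℝ, E), M; ℝ⟯, (∀ᶠ y in nhds x, ψ y = 1) ∧ tsupport ψ ⊆ interior u := by
  obtain ⟨ψ, -, hψ⟩ := ((SmoothBumpFunction.nhds_basis_tsupport (I := 𝓘(ℝ, E)) x).mem_iff).1
    (interior_mem_nhds.2 hu)
  exact ⟨⟨ψ, ψ.contMDiff⟩, ψ.eventuallyEq_one, hψ⟩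

variable (FV V) in
/-- A section that is smooth on `u`, times a function supported in `u`, is smooth. -/
def SmoothSection.cutoff {u : Set M} (ψ : C^∞⟮𝓘(ℝ, E), M; ℝ⟯) (hψ : tsupport ψ ⊆ interior u)
    (s : ∀ y, V y) (hs : ContMDiffOn 𝓘(ℝ, E) (𝓘(ℝ, E).prod 𝓘(ℝ, FV)) ∞
      (fun y => TotalSpace.mk' FV y (s y)) u) : SmoothSection E FV V :=
  ⟨fun y => ψ y • s y, ContMDiffOn.smul_section_of_tsupport ψ.contMDiff.contMDiffOn
    isOpen_interior hψ (hs.mono interior_subset)⟩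

variable [ContMDiffVectorBundle ∞ FV V 𝓘(ℝ, E)]

/-- Every vector of a fibre is the value of a global smooth section. -/
theorem SmoothSection.exists_eq {x : M} (v : V x) : ∃ s : SmoothSection E FV V, s x = v := by
  obtain ⟨u, hu, h⟩ := FiberBundle.exists_contMDiffOn_extend (k := ∞) 𝓘(ℝ, E) FV v
  obtain ⟨ψ, h1, h2⟩ := exists_smooth_cutoff (E := E) hu
  refine ⟨SmoothSection.cutoff FV V ψ h2 _ h, ?_⟩
  change ψ x • FiberBundle.extend FV v x = v
  simp [h1.self_of_nhds]

/-- An operator on sections which is linear over functions, evaluated at `x`,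
only depends on the value of the section at `x`. -/
theorem SmoothSection.tensorial [FiniteDimensional ℝ FV] {W : Type*} [AddCommGroup W] [Module ℝ W] {x : M}
    (T : SmoothSection E FV V →ₗ[ℝ] W)
    (hT : ∀ f s, T (SmoothSection.fmul f s) = f x • T s)
    {s t : SmoothSection E FV V} (hst : s x = t x) : T s = T t := by
  have : ContMDiffVectorBundle 1 FV V 𝓘(ℝ, E) := ContMDiffVectorBundle.of_le (n := ∞) (by simp)
  rw [← sub_eq_zero, ← map_sub]
  set r := s - t with hr
  have hrx : r x = 0 := by simp [hr, hst]
  set e := trivializationAt FV V x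
  have hx : x ∈ e.baseSet := mem_baseSet_trivializationAt FV V x
  let b := Module.finBasis ℝ FV
  obtain ⟨ψ, h1, h2⟩ := exists_smooth_cutoff (E := E) (e.open_baseSet.mem_nhds hx)
  have h2' : tsupport ψ ⊆ e.baseSet := h2.trans interior_subset
  let c : Fin (Module.finrank ℝ FV) → C^∞⟮𝓘(ℝ, E), M; ℝ⟯ := fun i =>
    ⟨fun y => ψ y * e.localFrameCoeff 𝓘(ℝ, E) b i y (r y), by
      apply contMDiff_of_tsupport
      intro y hy
      have hy' : y ∈ e.baseSet := h2' (tsupport_mul_subset_left hy)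
      exact ψ.contMDiff.contMDiffAt.mul
        (contMDiffAt_localFrameCoeff (k := ∞) b hy' r.contMDiff.contMDiffAt i)⟩
  let σ : Fin (Module.finrank ℝ FV) → SmoothSection E FV V := fun i =>
    SmoothSection.cutoff FV V ψ h2 (e.localFrame b i) (e.contMDiffOn_localFrame_baseSet ∞ b i)
  have key : SmoothSection.fmul ψ (SmoothSection.fmul ψ r) =
      ∑ i, SmoothSection.fmul (c i) (σ i) := by
    ext y
    have : (∑ i, SmoothSection.fmul (c i) (σ i)) y = ∑ i, c i y • σ i y := by
      rw [← ContMDiffSection.coeAddHom_apply, map_sum, Finset.sum_apply]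
      rfl
    rw [this]
    by_cases hy : y ∈ e.baseSet
    · change ψ y • ψ y • r y =
        ∑ i, (ψ y * e.localFrameCoeff 𝓘(ℝ, E) b i y (r y)) • ψ y • e.localFrame b i y
      conv_lhs => rw [e.eq_sum_localFrameCoeff_smul (I := 𝓘(ℝ, E)) (b := b) (s := r) hy]
      simp only [Finset.smul_sum, smul_smul]
      exact Finset.sum_congr rfl fun i _ => by ring_nf
    · have : ψ y = 0 := image_eq_zero_of_notMem_tsupport fun h => hy (h2' h)
      change ψ y • ψ y • r y =
        ∑ i, (ψ y * e.localFrameCoeff 𝓘(ℝ, E) b i y (r y)) • ψ y • e.localFrame b i y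
      simp [this]
  have h3 : T (SmoothSection.fmul ψ (SmoothSection.fmul ψ r)) = T r := by
    rw [hT, hT, h1.self_of_nhds]; simp
  rw [← h3, key, map_sum]
  refine Finset.sum_eq_zero fun i _ => ?_
  rw [hT]
  have : c i x = 0 := by
    change ψ x * e.localFrameCoeff 𝓘(ℝ, E) b i x (r x) = 0
    simp [hrx]
  simp [this]

end Sections

/-! ### First cohomology of a Lie algebra -/

section LieCohomology

variable (𝔤 : Type*) [LieRing 𝔤] [LieAlgebra ℝ 𝔤]
  (W : Type*) [AddCommGroup W] [Module ℝ W] [LieRingModule 𝔤 W] [LieModule ℝ 𝔤 W]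

/-- `D¹(𝔤, W)`: the kernel of the Chevalley-Eilenberg differential `C¹(𝔤, W) → C²(𝔤, W)`. -/
def LieOneCocycle : Submodule ℝ (𝔤 →ₗ[ℝ] W) :=
  LinearMap.ker (LieModule.Cohomology.d₁₂ ℝ 𝔤 W)

variable {𝔤 W} in
theorem mem_lieOneCocycle (c : 𝔤 →ₗ[ℝ] W) :
    c ∈ LieOneCocycle 𝔤 W ↔ ∀ u v, c ⁅u, v⁆ = ⁅u, c v⁆ - ⁅v, c u⁆ := by
  refine ⟨fun h u v => ?_, fun h => ?_⟩
  · have h' : LieModule.Cohomology.d₁₂ ℝ 𝔤 W c = 0 := h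
    have := LieModule.Cohomology.d₁₂_apply_apply ℝ 𝔤 W c u v
    rw [h'] at this
    exact (sub_eq_zero.1 this.symm).symm
  · refine LinearMap.mem_ker.2 (Subtype.ext (LinearMap.ext₂ fun u v => ?_))
    change ⁅u, c v⁆ - ⁅v, c u⁆ - c ⁅u, v⁆ = 0
    rw [h, sub_self]

/-- The Chevalley-Eilenberg differential `W = C⁰(𝔤, W) → C¹(𝔤, W)`, `w ↦ (u ↦ u · w)`. -/
def lieD₀₁ : W →ₗ[ℝ] 𝔤 →ₗ[ℝ] W where
  toFun w := { toFun := fun u => ⁅u, w⁆, map_add' := fun u v => add_lie u v w,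
               map_smul' := fun r u => smul_lie r u w }
  map_add' w w' := by ext u; exact lie_add u w w'
  map_smul' r w := by ext u; exact lie_smul r u w

@[simp] theorem lieD₀₁_apply (w : W) (u : 𝔤) : lieD₀₁ 𝔤 W w u = ⁅u, w⁆ := rfl

/-- `B¹(𝔤, W)`: the 1-coboundaries. -/
def LieOneCoboundary : Submodule ℝ (𝔤 →ₗ[ℝ] W) := LinearMap.range (lieD₀₁ 𝔤 W)

theorem lieOneCoboundary_le : LieOneCoboundary 𝔤 W ≤ LieOneCocycle 𝔤 W := by
  rintro _ ⟨w, rfl⟩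
  rw [mem_lieOneCocycle]
  intro u v
  simp

/-- `H¹(𝔤, W) = D¹(𝔤, W) / B¹(𝔤, W)`. -/
abbrev LieH1 : Type _ := LieOneCocycle 𝔤 W ⧸ (LieOneCoboundary 𝔤 W).submoduleOf (LieOneCocycle 𝔤 W)

/-- The projection `D¹(𝔤, W) → H¹(𝔤, W)`. -/
def LieH1.proj : LieOneCocycle 𝔤 W →ₗ[ℝ] LieH1 𝔤 W := Submodule.mkQ _

end LieCohomology

/-! ### One-cochains: smooth bundle maps -/

section Cochains

variable {E : Type*} [NormedAddCommGroup E] [NormedSpace ℝ E]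
  {M : Type*} [TopologicalSpace M] [ChartedSpace E M]
  {FA : Type*} [NormedAddCommGroup FA] [NormedSpace ℝ FA]
  {A : M → Type*} [TopologicalSpace (TotalSpace FA A)]
  [∀ x, AddCommGroup (A x)] [∀ x, Module ℝ (A x)] [∀ x, TopologicalSpace (A x)]
  [FiberBundle FA A] [VectorBundle ℝ FA A]
  {FF : Type*} [NormedAddCommGroup FF] [NormedSpace ℝ FF]
  {F : M → Type*} [TopologicalSpace (TotalSpace FF F)]
  [∀ x, AddCommGroup (F x)] [∀ x, Module ℝ (F x)] [∀ x, TopologicalSpace (F x)]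
  [FiberBundle FF F] [VectorBundle ℝ FF F]
  [∀ x, IsTopologicalAddGroup (F x)] [∀ x, ContinuousSMul ℝ (F x)]

variable (E FA A FF F) in
/-- `C¹(A, F)`: the smooth vector bundle maps `A → F` over the identity of `M`, i.e. the smooth
sections of the bundle `Hom(A, F)`. -/
abbrev AlgebroidCochain : Type _ :=
  ContMDiffSection 𝓘(ℝ, E) (FA →L[ℝ] FF) ∞ (fun x => A x →L[ℝ] F x)

namespace AlgebroidCochain

/-- The section `Ω(a) ∈ Γ(F)` for `Ω ∈ C¹(A, F)` and `a ∈ Γ(A)`. -/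
def onSection [ContMDiffVectorBundle ∞ FA A 𝓘(ℝ, E)] [ContMDiffVectorBundle ∞ FF F 𝓘(ℝ, E)]
    (Ω : AlgebroidCochain E FA A FF F) (a : SmoothSection E FA A) : SmoothSection E FF F :=
  ⟨fun x => Ω x (a x), Ω.contMDiff.clm_bundle_apply a.contMDiff⟩

section
variable [ContMDiffVectorBundle ∞ FA A 𝓘(ℝ, E)] [ContMDiffVectorBundle ∞ FF F 𝓘(ℝ, E)]
  (Ω Ω' : AlgebroidCochain E FA A FF F) (a : SmoothSection E FA A)

@[simp] theorem onSection_apply (x : M) : Ω.onSection a x = Ω x (a x) := rfl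
theorem onSection_add : onSection (Ω + Ω') a = Ω.onSection a + Ω'.onSection a := rfl
theorem onSection_zero : onSection (0 : AlgebroidCochain E FA A FF F) a = 0 := rfl
theorem onSection_smul (r : ℝ) : onSection (r • Ω) a = r • Ω.onSection a := rfl
end

variable [FiniteDimensional ℝ E] [T2Space M] [IsManifold 𝓘(ℝ, E) ∞ M]
  [FiniteDimensional ℝ FA] [ContMDiffVectorBundle ∞ FA A 𝓘(ℝ, E)]
  [ContMDiffVectorBundle ∞ FF F 𝓘(ℝ, E)]

/-- A fibrewise linear map sending smooth sections to smooth sections is smooth. -/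
theorem contMDiff_of_section (φ : ∀ x, A x →L[ℝ] F x)
    (hφ : ∀ a : SmoothSection E FA A, ContMDiff 𝓘(ℝ, E) (𝓘(ℝ, E).prod 𝓘(ℝ, FF)) ∞
      (fun x => TotalSpace.mk' FF x (φ x (a x)))) :
    ContMDiff 𝓘(ℝ, E) (𝓘(ℝ, E).prod 𝓘(ℝ, FA →L[ℝ] FF)) ∞
      (fun x => TotalSpace.mk' (FA →L[ℝ] FF) (E := fun x => A x →L[ℝ] F x) x (φ x)) := by
  intro x
  rw [contMDiffAt_hom_bundle]
  refine ⟨contMDiffAt_id, ?_⟩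
  set R : M → FA →L[ℝ] FF := fun y => ContinuousLinearMap.inCoordinates FA A FF F x y x y (φ y)
  change ContMDiffAt 𝓘(ℝ, E) 𝓘(ℝ, FA →L[ℝ] FF) ∞ R x
  have hR : ∀ v : FA, ContMDiffAt 𝓘(ℝ, E) 𝓘(ℝ, FF) ∞ (fun y => R y v) x := by
    intro v
    set eA := trivializationAt FA A x
    set eF := trivializationAt FF F x
    have hxA : eA.baseSet ∈ nhds x := eA.open_baseSet.mem_nhds (mem_baseSet_trivializationAt FA A x)
    have hxF : eF.baseSet ∈ nhds x := eF.open_baseSet.mem_nhds (mem_baseSet_trivializationAt FF F x)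
    have hs : ContMDiffOn 𝓘(ℝ, E) (𝓘(ℝ, E).prod 𝓘(ℝ, FA)) ∞
        (fun y => TotalSpace.mk' FA y (eA.symm y v)) eA.baseSet := by
      rw [eA.contMDiffOn_section_baseSet_iff]
      refine (contMDiffOn_const (c := v)).congr fun y hy => ?_
      simp [hy]
    obtain ⟨ψ, h1, h2⟩ := exists_smooth_cutoff (E := E) hxA
    have h := (contMDiffAt_section x).1
      ((hφ (SmoothSection.cutoff FA A ψ h2 _ hs)).contMDiffAt (x := x))
    refine h.congr_of_eventuallyEq ?_
    filter_upwards [h1, hxA, hxF] with y hy hyA hyF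
    have : SmoothSection.cutoff FA A ψ h2 _ hs y = eA.symm y v := by
      change ψ y • eA.symm y v = _
      rw [hy, one_smul]
    rw [this]
    simp only [R, ContinuousLinearMap.inCoordinates_eq hyA hyF]
    simp [eA, eF]
  let b := Module.finBasis ℝ FA
  have hsum : R = fun y => ∑ i, ContinuousLinearMap.smulRightL ℝ FA FF
      (LinearMap.toContinuousLinearMap (b.coord i)) (R y (b i)) := by
    funext y
    ext v
    conv_lhs => rw [← b.sum_repr v, map_sum]
    simp
  rw [hsum]
  refine ContMDiffAt.sum fun i _ => ?_
  exact (ContinuousLinearMap.contMDiff _).contMDiffAt.comp x (hR (b i))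

variable [∀ x, IsTopologicalAddGroup (A x)] [∀ x, ContinuousSMul ℝ (A x)]

/-- The 1-cochain defined by a fibrewise linear map sending smooth sections to smooth sections. -/
def ofLinear (φ : ∀ x, A x →ₗ[ℝ] F x)
    (hφ : ∀ a : SmoothSection E FA A, ContMDiff 𝓘(ℝ, E) (𝓘(ℝ, E).prod 𝓘(ℝ, FF)) ∞
      (fun x => TotalSpace.mk' FF x (φ x (a x)))) : AlgebroidCochain E FA A FF F :=
  ⟨fun x =>
    have : T2Space (A x) := FiberBundle.t2Space FA A x
    have : FiniteDimensional ℝ (A x) := VectorBundle.finiteDimensional ℝ FA A x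
    LinearMap.toContinuousLinearMap (φ x), contMDiff_of_section _ hφ⟩

end AlgebroidCochain

end Cochains

/-! ### Lie algebroids -/

section Algebroid

variable (E : Type*) [NormedAddCommGroup E] [NormedSpace ℝ E]
  {M : Type*} [TopologicalSpace M] [ChartedSpace E M] [IsManifold 𝓘(ℝ, E) ∞ M]
  (FA : Type*) [NormedAddCommGroup FA] [NormedSpace ℝ FA]
  (A : M → Type*) [TopologicalSpace (TotalSpace FA A)]
  [∀ x, AddCommGroup (A x)] [∀ x, Module ℝ (A x)] [∀ x, TopologicalSpace (A x)]
  [FiberBundle FA A] [VectorBundle ℝ FA A]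

/-- A Lie algebroid structure on the vector bundle `A → M`: a smooth bundle map
`ρ : A → TM` and a real Lie bracket on `Γ(A)` such that `ρ : Γ(A) → 𝔛(M)` is a morphism of Lie
algebras and `[a, f b] = f [a, b] + (ρ(a) f) b`. -/
structure LieAlgebroid where
  /-- the anchor `ρ` -/
  anchor : ContMDiffSection 𝓘(ℝ, E) (FA →L[ℝ] E) ∞
    (fun x => A x →L[ℝ] TangentSpace 𝓘(ℝ, E) x)
  /-- the bracket of sections -/
  bracket : SmoothSection E FA A →ₗ[ℝ] SmoothSection E FA A →ₗ[ℝ] SmoothSection E FA A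
  bracket_self : ∀ a, bracket a a = 0
  jacobi : ∀ a b c,
    bracket a (bracket b c) + bracket b (bracket c a) + bracket c (bracket a b) = 0
  anchor_bracket : ∀ a b x, anchor x (bracket a b x) =
    VectorField.mlieBracket 𝓘(ℝ, E) (fun y => anchor y (a y)) (fun y => anchor y (b y)) x
  leibniz : ∀ a b (f : C^∞⟮𝓘(ℝ, E), M; ℝ⟯) x,
    bracket a (SmoothSection.fmul f b) x =
      f x • bracket a b x + dirDeriv f (anchor x (a x)) • b x

variable {E FA A}

namespace LieAlgebroid

variable (𝒜 : LieAlgebroid E FA A)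

/-- A Lie algebroid is transitive if its anchor is (fibrewise) surjective. -/
def IsTransitive : Prop := ∀ x, Function.Surjective (𝒜.anchor x)

/-- The fibre `L_x = Ker(ρ_x)` of the adjoint bundle. -/
def adjointFiber (x : M) : Submodule ℝ (A x) := LinearMap.ker (𝒜.anchor x).toLinearMap

theorem mem_adjointFiber {x : M} {u : A x} : u ∈ 𝒜.adjointFiber x ↔ 𝒜.anchor x u = 0 :=
  LinearMap.mem_ker

theorem bracket_skew (a b : SmoothSection E FA A) : 𝒜.bracket a b = - 𝒜.bracket b a := by
  have h := 𝒜.bracket_self (a + b)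
  simp only [map_add, LinearMap.add_apply, 𝒜.bracket_self, zero_add, add_zero] at h
  exact eq_neg_of_add_eq_zero_right h

theorem bracket_mem_adjointFiber {x : M} {a b : SmoothSection E FA A}
    (ha : a x ∈ 𝒜.adjointFiber x) (hb : b x ∈ 𝒜.adjointFiber x) :
    𝒜.bracket a b x ∈ 𝒜.adjointFiber x := by
  rw [mem_adjointFiber] at *
  rw [𝒜.anchor_bracket, ← VectorField.mlieBracketWithin_univ]
  exact VectorField.mlieBracketWithin_eq_zero_of_eq_zero ha hb

variable [FiniteDimensional ℝ E] [T2Space M] [ContMDiffVectorBundle ∞ FA A 𝓘(ℝ, E)]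

/-- A smooth section through a given vector. -/
def ext {x : M} (u : A x) : SmoothSection E FA A := (SmoothSection.exists_eq u).choose

@[simp] theorem ext_apply {x : M} (u : A x) : (ext u : SmoothSection E FA A) x = u :=
  (SmoothSection.exists_eq u).choose_spec

variable [FiniteDimensional ℝ FA]

theorem bracket_congr_right {x : M} {a b b' : SmoothSection E FA A}
    (ha : a x ∈ 𝒜.adjointFiber x) (hb : b x = b' x) :
    𝒜.bracket a b x = 𝒜.bracket a b' x := by
  let T : SmoothSection E FA A →ₗ[ℝ] A x :=
    { toFun := fun b => 𝒜.bracket a b x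
      map_add' := fun b c => by simp
      map_smul' := fun r b => by simp }
  refine SmoothSection.tensorial T (fun f s => ?_) hb
  change 𝒜.bracket a (SmoothSection.fmul f s) x = f x • 𝒜.bracket a s x
  rw [𝒜.leibniz, (𝒜.mem_adjointFiber).1 ha]
  simp

theorem bracket_congr {x : M} {a a' b b' : SmoothSection E FA A}
    (ha : a x ∈ 𝒜.adjointFiber x) (hb : b x ∈ 𝒜.adjointFiber x)
    (haa : a x = a' x) (hbb : b x = b' x) :
    𝒜.bracket a b x = 𝒜.bracket a' b' x := by
  rw [𝒜.bracket_congr_right ha hbb, 𝒜.bracket_skew a b', 𝒜.bracket_skew a' b']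
  have := 𝒜.bracket_congr_right (a := b') (hbb ▸ hb) haa
  simp [this]

/-- The bracket of the isotropy Lie algebra `L_x`: `[a(x), b(x)] = [a, b](x)` for smooth sections
`a`, `b` of `A` whose values at `x` lie in `L_x`. -/
instance (x : M) : Bracket (𝒜.adjointFiber x) (𝒜.adjointFiber x) where
  bracket u v := ⟨𝒜.bracket (ext (u : A x)) (ext (v : A x)) x,
    𝒜.bracket_mem_adjointFiber (by simp) (by simp)⟩

theorem coe_lie {x : M} (u v : 𝒜.adjointFiber x) {a b : SmoothSection E FA A}
    (ha : a x = u) (hb : b x = v) : (⁅u, v⁆ : 𝒜.adjointFiber x) = 𝒜.bracket a b x :=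
  𝒜.bracket_congr (by simp) (by simp) (by simp [ha]) (by simp [hb])

instance (x : M) : LieRing (𝒜.adjointFiber x) where
  add_lie u v w := by
    ext
    rw [𝒜.coe_lie (u + v) w (a := ext (u : A x) + ext (v : A x)) (by simp) (ext_apply _)]
    simp [𝒜.coe_lie _ _ (ext_apply _) (ext_apply _)]
  lie_add u v w := by
    ext
    rw [𝒜.coe_lie u (v + w) (b := ext (v : A x) + ext (w : A x)) (ext_apply _) (by simp)]
    simp [𝒜.coe_lie _ _ (ext_apply _) (ext_apply _)]
  lie_self u := by
    ext
    simp [𝒜.coe_lie _ _ (ext_apply _) (ext_apply _), 𝒜.bracket_self]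
  leibniz_lie u v w := by
    ext
    have h := 𝒜.jacobi (ext (u : A x)) (ext (v : A x)) (ext (w : A x))
    have hv := fun p q : 𝒜.adjointFiber x => (𝒜.coe_lie p q (ext_apply _) (ext_apply _)).symm
    rw [𝒜.coe_lie u ⁅v, w⁆ (ext_apply _) (hv v w), Submodule.coe_add,
      𝒜.coe_lie ⁅u, v⁆ w (hv u v) (ext_apply _), 𝒜.coe_lie v ⁅u, w⁆ (ext_apply _) (hv u w)]
    rw [𝒜.bracket_skew (ext (w : A x)) (ext (u : A x)), map_neg,
      𝒜.bracket_skew (ext (w : A x))] at h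
    have h' := congrArg (fun s : SmoothSection E FA A => s x) h
    simp only [ContMDiffSection.coe_add, ContMDiffSection.coe_neg, Pi.add_apply, Pi.neg_apply,
      ContMDiffSection.coe_zero, Pi.zero_apply] at h'
    rw [← sub_eq_zero, ← h']
    abel

instance (x : M) : LieAlgebra ℝ (𝒜.adjointFiber x) where
  lie_smul r u v := by
    ext
    rw [𝒜.coe_lie u (r • v) (b := r • ext (v : A x)) (ext_apply _) (by simp)]
    simp [𝒜.coe_lie _ _ (ext_apply _) (ext_apply _)]

end LieAlgebroid

namespace LieAlgebroid

/-- If `A` is transitive, every `u ∈ L_x` is the value of a global smooth section of `A` with values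
in the adjoint bundle `L = Ker(ρ)`. -/
theorem exists_adjoint_section [FiniteDimensional ℝ E] [T2Space M]
    [ContMDiffVectorBundle ∞ FA A 𝓘(ℝ, E)] [FiniteDimensional ℝ FA] (𝒜 : LieAlgebroid E FA A)
    (h𝒜 : 𝒜.IsTransitive) {x : M} {u : A x}
    (hu : u ∈ 𝒜.adjointFiber x) :
    ∃ w : SmoothSection E FA A, (∀ y, w y ∈ 𝒜.adjointFiber y) ∧ w x = u := by
  set eA := trivializationAt FA A x
  set eT := trivializationAt E (TangentSpace 𝓘(ℝ, E)) x
  have hxA : x ∈ eA.baseSet := mem_baseSet_trivializationAt FA A x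
  have hxT : x ∈ eT.baseSet := mem_baseSet_trivializationAt E (TangentSpace 𝓘(ℝ, E)) x
  set R : M → FA →L[ℝ] E := fun y =>
    ContinuousLinearMap.inCoordinates FA A E (TangentSpace 𝓘(ℝ, E)) x y x y (𝒜.anchor y) with hR
  have hRs : ∀ y ∈ eA.baseSet ∩ eT.baseSet, ContMDiffAt 𝓘(ℝ, E) 𝓘(ℝ, FA →L[ℝ] E) ∞ R y := by
    intro y hy
    have h := ((trivializationAt (FA →L[ℝ] E)
      (fun x => A x →L[ℝ] TangentSpace 𝓘(ℝ, E) x) x).contMDiffAt_section_iff (IB := 𝓘(ℝ, E))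
        (n := ∞) (x₀ := y) (s := fun y => 𝒜.anchor y) (by simpa [eA, eT] using hy)).1
      𝒜.anchor.contMDiff.contMDiffAt
    exact h
  have hRapp : ∀ y ∈ eA.baseSet ∩ eT.baseSet, ∀ v : FA, R y v = 0 →
      eA.symm y v ∈ 𝒜.adjointFiber y := by
    intro y hy v hv
    rw [hR] at hv
    simp only [ContinuousLinearMap.inCoordinates_eq hy.1 hy.2, ContinuousLinearMap.comp_apply,
      ContinuousLinearEquiv.coe_coe, map_eq_zero_iff _ (ContinuousLinearEquiv.injective _)] at hv
    rw [mem_adjointFiber]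
    simpa using hv
  have hB : eA.baseSet ∩ eT.baseSet ∈ nhds x :=
    Filter.inter_mem (eA.open_baseSet.mem_nhds hxA) (eT.open_baseSet.mem_nhds hxT)
  have hsurj : Function.Surjective (R x).toLinearMap := by
    intro t
    obtain ⟨a, ha⟩ := h𝒜 x ((eT.continuousLinearEquivAt ℝ x hxT).symm t)
    refine ⟨eA.continuousLinearEquivAt ℝ x hxA a, ?_⟩
    rw [hR, ContinuousLinearMap.coe_coe]
    simp only [ContinuousLinearMap.inCoordinates_eq hxA hxT, ContinuousLinearMap.comp_apply,
      ContinuousLinearEquiv.coe_coe]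
    have e := (eA.continuousLinearEquivAt ℝ x hxA).symm_apply_apply a
    rw [e, ha]
    exact ContinuousLinearEquiv.apply_symm_apply _ _
  obtain ⟨S', hS'⟩ := (R x).toLinearMap.exists_rightInverse_of_surjective
    (LinearMap.range_eq_top.2 hsurj)
  set S : E →L[ℝ] FA := LinearMap.toContinuousLinearMap S'
  have := FiniteDimensional.complete ℝ E
  let G : M → E →L[ℝ] E := fun y => (R y).comp S
  have hGs : ∀ y ∈ eA.baseSet ∩ eT.baseSet, ContMDiffAt 𝓘(ℝ, E) 𝓘(ℝ, E →L[ℝ] E) ∞ G y :=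
    fun y hy => (hRs y hy).clm_comp contMDiffAt_const
  have hGx : G x = 1 := by
    ext t
    exact LinearMap.congr_fun hS' t
  have hU : (eA.baseSet ∩ eT.baseSet) ∩ {y | IsUnit (G y)} ∈ nhds x := by
    have h1 : {g : E →L[ℝ] E | IsUnit g} ∈ nhds (G x) :=
      Units.isOpen.mem_nhds (by rw [hGx]; exact isUnit_one)
    exact Filter.inter_mem hB ((hGs x ⟨hxA, hxT⟩).continuousAt.preimage_mem_nhds h1)
  set u0 : FA := (eA ⟨x, u⟩).2
  have hu0 : eA.symm x u0 = u := by simp [u0, hxA]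
  let k : M → FA := fun y => u0 - S (Ring.inverse (G y) (R y u0))
  have hk : ContMDiffOn 𝓘(ℝ, E) (𝓘(ℝ, E).prod 𝓘(ℝ, FA)) ∞
      (fun y => TotalSpace.mk' FA y (eA.symm y (k y)))
      ((eA.baseSet ∩ eT.baseSet) ∩ {y | IsUnit (G y)}) := by
    rintro y ⟨hy, g, hg⟩
    refine ContMDiffAt.contMDiffWithinAt ?_
    rw [eA.contMDiffAt_section_iff hy.1]
    have hinv : ContMDiffAt 𝓘(ℝ, E) 𝓘(ℝ, E →L[ℝ] E) ∞ (fun y => Ring.inverse (G y)) y :=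
      ContMDiffAt.comp (g := Ring.inverse) y
        (by rw [← hg]; exact (contDiffAt_ringInverse ℝ g).contMDiffAt) (hGs y hy)
    have hks : ContMDiffAt 𝓘(ℝ, E) 𝓘(ℝ, FA) ∞ k y :=
      contMDiffAt_const.sub ((contMDiffAt_const (c := S)).clm_apply
        (hinv.clm_apply ((hRs y hy).clm_apply contMDiffAt_const)))
    refine hks.congr_of_eventuallyEq ?_
    filter_upwards [eA.open_baseSet.mem_nhds hy.1] with z hz
    simp [hz]
  obtain ⟨ψ, h1, h2⟩ := exists_smooth_cutoff (E := E) hU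
  refine ⟨SmoothSection.cutoff FA A ψ h2 _ hk, fun y => ?_, ?_⟩
  · change ψ y • eA.symm y (k y) ∈ _
    by_cases hy : y ∈ tsupport ψ
    · obtain ⟨hy, g, hg⟩ := interior_subset (h2 hy)
      refine Submodule.smul_mem _ _ (hRapp y hy _ ?_)
      have e : R y (S (Ring.inverse (G y) (R y u0))) = R y u0 := by
        change (G y * Ring.inverse (G y)) (R y u0) = R y u0
        rw [Ring.mul_inverse_cancel _ ⟨g, hg⟩]
        rfl
      simp only [k, map_sub, e, sub_self]
    · rw [image_eq_zero_of_notMem_tsupport hy, zero_smul]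
      exact Submodule.zero_mem _
  · change ψ x • eA.symm x (k x) = u
    have e : R x u0 = 0 := by
      rw [hR]
      simp only [ContinuousLinearMap.inCoordinates_eq hxA hxT, ContinuousLinearMap.comp_apply,
        ContinuousLinearEquiv.coe_coe]
      have : (eA.continuousLinearEquivAt ℝ x hxA).symm u0 = u := by simpa using hu0
      rw [this, (𝒜.mem_adjointFiber).1 hu, map_zero]
    have : k x = u0 := by simp [k, e]
    rw [this, hu0, h1.self_of_nhds, one_smul]

end LieAlgebroid

/-! ### Representations -/

variable {FF : Type*} [NormedAddCommGroup FF] [NormedSpace ℝ FF]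
  {F : M → Type*} [TopologicalSpace (TotalSpace FF F)]
  [∀ x, AddCommGroup (F x)] [∀ x, Module ℝ (F x)] [∀ x, TopologicalSpace (F x)]
  [FiberBundle FF F] [VectorBundle ℝ FF F]
  [∀ x, IsTopologicalAddGroup (F x)] [∀ x, ContinuousSMul ℝ (F x)]

/-- `D : Γ(F) → F_x` is a covariant differential operator at `x`, i.e. an element of `CDO(F)_x`,
with symbol `X ∈ T_x M`: `D(f μ) = X(f) μ(x) + f(x) D(μ)`. -/
def IsCovariantDiffOp {x : M} (X : TangentSpace 𝓘(ℝ, E) x)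
    (D : SmoothSection E FF F →ₗ[ℝ] F x) : Prop :=
  ∀ (f : C^∞⟮𝓘(ℝ, E), M; ℝ⟯) (μ : SmoothSection E FF F),
    D (SmoothSection.fmul f μ) = dirDeriv f X • μ x + f x • D μ

variable (FF F) in
/-- A representation of the Lie algebroid `A` on the vector bundle `F`: a smooth bundle map
`𝔏 : A → CDO(F)` (smooth means that it sends smooth sections of `A` to differential operators
`Γ(F) → Γ(F)`), compatible with anchor and symbol, and with the brackets. -/
structure LieAlgebroid.Representation (𝒜 : LieAlgebroid E FA A) where
  /-- the operator `𝔏_a : Γ(F) → F_x` for `a ∈ A_x` -/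
  toFun : ∀ x, A x →ₗ[ℝ] SmoothSection E FF F →ₗ[ℝ] F x
  isCovariantDiffOp : ∀ x (a : A x), IsCovariantDiffOp (𝒜.anchor x a) (toFun x a)
  smooth : ∀ (a : SmoothSection E FA A) (μ : SmoothSection E FF F),
    ContMDiff 𝓘(ℝ, E) (𝓘(ℝ, E).prod 𝓘(ℝ, FF)) ∞
      (fun x => TotalSpace.mk' FF x (toFun x (a x) μ))
  map_bracket : ∀ (a b : SmoothSection E FA A) (μ : SmoothSection E FF F) x,
    toFun x (𝒜.bracket a b x) μ =
      toFun x (a x) ⟨fun y => toFun y (b y) μ, smooth b μ⟩ -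
        toFun x (b x) ⟨fun y => toFun y (a y) μ, smooth a μ⟩

namespace LieAlgebroid.Representation

variable {𝒜 : LieAlgebroid E FA A} (𝔏 : 𝒜.Representation FF F)

/-- The section `𝔏_a μ`. -/
def act (a : SmoothSection E FA A) (μ : SmoothSection E FF F) : SmoothSection E FF F :=
  ⟨fun x => 𝔏.toFun x (a x) μ, 𝔏.smooth a μ⟩

@[simp] theorem act_apply (a : SmoothSection E FA A) (μ : SmoothSection E FF F) (x : M) :
    𝔏.act a μ x = 𝔏.toFun x (a x) μ := rfl

/-- The fibre `F_x`, regarded as a module over the Lie algebra `L_x` by means of `𝔏`. -/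
def Fiber (_𝔏 : 𝒜.Representation FF F) (x : M) : Type _ := F x

instance (x : M) : AddCommGroup (𝔏.Fiber x) := inferInstanceAs (AddCommGroup (F x))

instance (x : M) : Module ℝ (𝔏.Fiber x) := inferInstanceAs (Module ℝ (F x))

variable [FiniteDimensional ℝ E] [T2Space M] [ContMDiffVectorBundle ∞ FA A 𝓘(ℝ, E)]
  [FiniteDimensional ℝ FA] [ContMDiffVectorBundle ∞ FF F 𝓘(ℝ, E)] [FiniteDimensional ℝ FF]

theorem toFun_congr {x : M} {u : A x} (hu : u ∈ 𝒜.adjointFiber x)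
    {μ μ' : SmoothSection E FF F} (h : μ x = μ' x) : 𝔏.toFun x u μ = 𝔏.toFun x u μ' := by
  refine SmoothSection.tensorial (𝔏.toFun x u) (fun f s => ?_) h
  rw [𝔏.isCovariantDiffOp x u f s, (𝒜.mem_adjointFiber).1 hu]
  simp

/-- The identity map `F_x → F_x`, with the target regarded as an `L_x`-module. -/
def toFiber (x : M) : F x ≃ₗ[ℝ] 𝔏.Fiber x := LinearEquiv.refl ℝ (F x)

theorem exists_section {x : M} (m : 𝔏.Fiber x) :
    ∃ μ : SmoothSection E FF F, 𝔏.toFiber x (μ x) = m := by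
  obtain ⟨μ, hμ⟩ := SmoothSection.exists_eq (E := E) (FV := FF) ((𝔏.toFiber x).symm m)
  exact ⟨μ, by rw [hμ, LinearEquiv.apply_symm_apply]⟩

/-- The action of `L_x` on `F_x`: `u · μ(x) = 𝔏_u μ` for `u ∈ L_x` and `μ ∈ Γ(F)`. -/
instance (x : M) : Bracket (𝒜.adjointFiber x) (𝔏.Fiber x) where
  bracket u m := 𝔏.toFiber x (𝔏.toFun x u (𝔏.exists_section m).choose)

theorem lie_eq {x : M} (u : 𝒜.adjointFiber x) (μ : SmoothSection E FF F) :
    ⁅u, 𝔏.toFiber x (μ x)⁆ = 𝔏.toFiber x (𝔏.toFun x u μ) :=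
  congrArg (𝔏.toFiber x) (𝔏.toFun_congr u.2 ((𝔏.toFiber x).injective
    (𝔏.exists_section (𝔏.toFiber x (μ x))).choose_spec))

instance (x : M) : LieRingModule (𝒜.adjointFiber x) (𝔏.Fiber x) where
  add_lie u v m := by
    obtain ⟨μ, rfl⟩ := 𝔏.exists_section m
    simp only [lie_eq, Submodule.coe_add, map_add, LinearMap.add_apply]
  lie_add u m n := by
    obtain ⟨μ, rfl⟩ := 𝔏.exists_section m
    obtain ⟨ν, rfl⟩ := 𝔏.exists_section n
    have h := 𝔏.lie_eq u (μ + ν)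
    rw [ContMDiffSection.coe_add, Pi.add_apply, map_add, map_add, map_add] at h
    rw [h, lie_eq, lie_eq]
  leibniz_lie u v m := by
    obtain ⟨μ, rfl⟩ := 𝔏.exists_section m
    have hb := 𝔏.map_bracket (ext (u : A x)) (ext (v : A x)) μ x
    rw [← 𝒜.coe_lie u v (ext_apply _) (ext_apply _), ext_apply, ext_apply] at hb
    have h1 := 𝔏.lie_eq u (𝔏.act (ext (v : A x)) μ)
    have h2 := 𝔏.lie_eq v (𝔏.act (ext (u : A x)) μ)
    rw [act_apply, ext_apply] at h1 h2
    rw [𝔏.lie_eq v, 𝔏.lie_eq u, h1, h2, lie_eq, hb, ← map_add]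
    exact congrArg _ (sub_add_cancel _ _).symm

instance (x : M) : LieModule ℝ (𝒜.adjointFiber x) (𝔏.Fiber x) where
  smul_lie r u m := by
    obtain ⟨μ, rfl⟩ := 𝔏.exists_section m
    simp only [lie_eq, Submodule.coe_smul, map_smul, LinearMap.smul_apply]
  lie_smul r u m := by
    obtain ⟨μ, rfl⟩ := 𝔏.exists_section m
    have h := 𝔏.lie_eq u (r • μ)
    rw [ContMDiffSection.coe_smul, Pi.smul_apply, map_smul, map_smul, map_smul] at h
    rw [h, lie_eq]

/-- `F_{0x} = {ν ∈ F_x | 𝔏_u ν = 0 for all u ∈ L_x} = H⁰(L_x, F_x)`, as an `L_x`-submodule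
of `F_x`. -/
abbrev F₀ (x : M) : LieSubmodule ℝ (𝒜.adjointFiber x) (𝔏.Fiber x) :=
  LieModule.maxTrivSubmodule ℝ (𝒜.adjointFiber x) (𝔏.Fiber x)

theorem mem_F₀ {x : M} {μ : SmoothSection E FF F} :
    𝔏.toFiber x (μ x) ∈ 𝔏.F₀ x ↔ ∀ u ∈ 𝒜.adjointFiber x, 𝔏.toFun x u μ = 0 := by
  rw [LieModule.mem_maxTrivSubmodule]
  simp [lie_eq]

/-- The smooth sections of `F₀`: the smooth sections of `F` with values in `F₀`. -/
def F₀Section : Submodule ℝ (SmoothSection E FF F) where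
  carrier := {ν | ∀ x, 𝔏.toFiber x (ν x) ∈ 𝔏.F₀ x}
  add_mem' h h' x := (𝔏.F₀ x).add_mem (h x) (h' x)
  zero_mem' x := (𝔏.F₀ x).zero_mem
  smul_mem' c _ h x := (𝔏.F₀ x).smul_mem c (h x)

/-- When `A` is transitive, `𝔏` restricts to `F₀`: `𝔏_a ν ∈ Γ(F₀)` for `a ∈ Γ(A)`, `ν ∈ Γ(F₀)`. -/
theorem act_mem_F₀Section (h𝒜 : 𝒜.IsTransitive) (a : SmoothSection E FA A)
    {ν : SmoothSection E FF F} (hν : ν ∈ 𝔏.F₀Section) : 𝔏.act a ν ∈ 𝔏.F₀Section := by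
  intro x
  rw [mem_F₀]
  intro u hu
  obtain ⟨w, hw, rfl⟩ := 𝒜.exists_adjoint_section h𝒜 hu
  have h0 : 𝔏.act w ν = 0 := by
    ext y
    exact 𝔏.mem_F₀.1 (hν y) _ (hw y)
  have h1 := 𝔏.map_bracket w a ν x
  have h2 : 𝒜.bracket w a x ∈ 𝒜.adjointFiber x := by
    rw [mem_adjointFiber, 𝒜.anchor_bracket]
    have : (fun y => 𝒜.anchor y (w y)) = 0 := funext fun y => (𝒜.mem_adjointFiber).1 (hw y)
    rw [this, VectorField.mlieBracket_zero_left]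
    rfl
  rw [𝔏.mem_F₀.1 (hν x) _ h2] at h1
  change 0 = 𝔏.toFun x (w x) (𝔏.act a ν) - 𝔏.toFun x (a x) (𝔏.act w ν) at h1
  rw [h0, map_zero, sub_zero] at h1
  exact h1.symm

/-! ### The first cohomology of `A` with values in `F` and in `F₀` -/

variable [∀ x, IsTopologicalAddGroup (A x)] [∀ x, ContinuousSMul ℝ (A x)]

/-- The coboundary `𝔡 μ ∈ C¹(A, F)` of `μ ∈ Γ(F)`: `(𝔡 μ)(a) = 𝔏_a μ`. -/
def d : SmoothSection E FF F →ₗ[ℝ] AlgebroidCochain E FA A FF F where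
  toFun μ := AlgebroidCochain.ofLinear (fun x => (𝔏.toFun x).flip μ) (fun a => 𝔏.smooth a μ)
  map_add' μ ν := by ext x a; exact map_add (𝔏.toFun x a) μ ν
  map_smul' r μ := by ext x a; exact map_smul (𝔏.toFun x a) r μ

theorem d_apply (μ : SmoothSection E FF F) (x : M) (a : A x) : 𝔏.d μ x a = 𝔏.toFun x a μ := rfl

/-- `D¹(A, F)`: the 1-cocycles, i.e. the 1-cochains `Ω` with
`Ω([a, b]) = 𝔏_a (Ω(b)) - 𝔏_b (Ω(a))`. -/
def D1 : Submodule ℝ (AlgebroidCochain E FA A FF F) where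
  carrier := {Ω | ∀ a b : SmoothSection E FA A,
    Ω.onSection (𝒜.bracket a b) = 𝔏.act a (Ω.onSection b) - 𝔏.act b (Ω.onSection a)}
  add_mem' {Ω Ω'} h h' a b := by
    ext x
    have e := congrArg (fun s : SmoothSection E FF F => s x) (h a b)
    have e' := congrArg (fun s : SmoothSection E FF F => s x) (h' a b)
    simp only [ContMDiffSection.coe_sub, Pi.sub_apply, act_apply] at e e' ⊢
    simp only [AlgebroidCochain.onSection_add, map_add, ContMDiffSection.coe_add,
      Pi.add_apply, e, e']
    abel
  zero_mem' a b := by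
    ext x
    simp [AlgebroidCochain.onSection_zero]
  smul_mem' r Ω h a b := by
    ext x
    have e := congrArg (fun s : SmoothSection E FF F => s x) (h a b)
    simp only [ContMDiffSection.coe_sub, Pi.sub_apply, act_apply] at e ⊢
    simp only [AlgebroidCochain.onSection_smul, map_smul, ContMDiffSection.coe_smul,
      Pi.smul_apply, e, smul_sub]

/-- `B¹(A, F)`: the 1-coboundaries. -/
def B1 : Submodule ℝ (AlgebroidCochain E FA A FF F) := LinearMap.range 𝔏.d

theorem B1_le_D1 : 𝔏.B1 ≤ 𝔏.D1 := by
  rintro _ ⟨μ, rfl⟩ a b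
  ext x
  exact 𝔏.map_bracket a b μ x

/-- `H¹(A, F) = D¹(A, F) / B¹(A, F)`. -/
abbrev H1 : Type _ := 𝔏.D1 ⧸ 𝔏.B1.submoduleOf 𝔏.D1

/-- `D¹(A, F₀)`: the 1-cocycles with values in `F₀`. -/
def D1₀ : Submodule ℝ (AlgebroidCochain E FA A FF F) where
  carrier := {Ω | Ω ∈ 𝔏.D1 ∧ ∀ x (a : A x), 𝔏.toFiber x (Ω x a) ∈ 𝔏.F₀ x}
  add_mem' h h' := ⟨𝔏.D1.add_mem h.1 h'.1, fun x a => (𝔏.F₀ x).add_mem (h.2 x a) (h'.2 x a)⟩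
  zero_mem' := ⟨𝔏.D1.zero_mem, fun x _ => (𝔏.F₀ x).zero_mem⟩
  smul_mem' c _ h := ⟨𝔏.D1.smul_mem c h.1, fun x a => (𝔏.F₀ x).smul_mem c (h.2 x a)⟩

theorem D1₀_le_D1 : 𝔏.D1₀ ≤ 𝔏.D1 := fun _ h => h.1

/-- `B¹(A, F₀)`: the coboundaries of the smooth sections of `F₀`. -/
def B1₀ : Submodule ℝ (AlgebroidCochain E FA A FF F) := 𝔏.F₀Section.map 𝔏.d

theorem B1₀_le_B1 : 𝔏.B1₀ ≤ 𝔏.B1 := LinearMap.map_le_range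

theorem B1₀_le_D1₀ (h𝒜 : 𝒜.IsTransitive) : 𝔏.B1₀ ≤ 𝔏.D1₀ := by
  rintro _ ⟨ν, hν, rfl⟩
  refine ⟨𝔏.B1_le_D1 ⟨ν, rfl⟩, fun x a => ?_⟩
  have h := 𝔏.act_mem_F₀Section h𝒜 (ext a) hν x
  rwa [act_apply, ext_apply] at h

/-- `H¹(A, F₀) = D¹(A, F₀) / B¹(A, F₀)`. -/
abbrev H1₀ : Type _ := 𝔏.D1₀ ⧸ 𝔏.B1₀.submoduleOf 𝔏.D1₀

/-- The projection `D¹(A, F₀) → H¹(A, F₀)`, `Ω ↦ [Ω]`. -/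
def proj₀ : 𝔏.D1₀ →ₗ[ℝ] 𝔏.H1₀ := Submodule.mkQ _

/-- The map `i_* : H¹(A, F₀) → H¹(A, F)` induced by the inclusion `F₀ ⊆ F`. -/
def inclH1 : 𝔏.H1₀ →ₗ[ℝ] 𝔏.H1 :=
  Submodule.mapQ _ _ (Submodule.inclusion 𝔏.D1₀_le_D1) (fun _ h => 𝔏.B1₀_le_B1 h)

/-! ### Localization -/

/-- Restriction of cocycles `D¹(A, F) → D¹(L_x, F_x)`, `Ω ↦ Ω|_{L_x}`. -/
def restrict (x : M) : 𝔏.D1 →ₗ[ℝ] LieOneCocycle (𝒜.adjointFiber x) (𝔏.Fiber x) where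
  toFun Ω := ⟨(𝔏.toFiber x).toLinearMap ∘ₗ (Ω.1 x).toLinearMap ∘ₗ
      (𝒜.adjointFiber x).subtype, by
    rw [mem_lieOneCocycle]
    intro u v
    have h := congrArg (fun s : SmoothSection E FF F => s x)
      (Ω.2 (ext (u : A x)) (ext (v : A x)))
    simp only [ContMDiffSection.coe_sub, Pi.sub_apply, act_apply, ext_apply,
      AlgebroidCochain.onSection_apply] at h
    rw [← 𝒜.coe_lie u v (ext_apply _) (ext_apply _)] at h
    have hu := 𝔏.lie_eq u (Ω.1.onSection (ext (v : A x)))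
    have hv := 𝔏.lie_eq v (Ω.1.onSection (ext (u : A x)))
    rw [AlgebroidCochain.onSection_apply, ext_apply] at hu hv
    change 𝔏.toFiber x (Ω.1 x (⁅u, v⁆ : 𝒜.adjointFiber x)) =
      ⁅u, 𝔏.toFiber x (Ω.1 x v)⁆ - ⁅v, 𝔏.toFiber x (Ω.1 x u)⁆
    rw [hu, hv, ← map_sub]
    exact congrArg _ h⟩
  map_add' _ _ := rfl
  map_smul' _ _ := rfl

/-- The localization map `Υ_x : H¹(A, F) → H¹(L_x, F_x)`, `[Ω] ↦ [Ω|_{L_x}]`. -/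
def localization (x : M) : 𝔏.H1 →ₗ[ℝ] LieH1 (𝒜.adjointFiber x) (𝔏.Fiber x) :=
  Submodule.mapQ _ _ (𝔏.restrict x) (by
    rintro ⟨_, hΩ⟩ ⟨μ, rfl⟩
    exact ⟨𝔏.toFiber x (μ x), LinearMap.ext fun u => 𝔏.lie_eq u μ⟩)

/-- Restriction of cocycles `D¹(A, F₀) → D¹(L_x, F_{0x})`, `Ω ↦ Ω|_{L_x}`. -/
def restrict₀ (x : M) : 𝔏.D1₀ →ₗ[ℝ] LieOneCocycle (𝒜.adjointFiber x) (𝔏.F₀ x) where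
  toFun Ω := ⟨LinearMap.codRestrict (𝔏.F₀ x).toSubmodule
      (𝔏.restrict x ⟨Ω.1, Ω.2.1⟩).1 (fun u => Ω.2.2 x u), by
    rw [mem_lieOneCocycle]
    intro u v
    exact Subtype.ext ((mem_lieOneCocycle _).1 (𝔏.restrict x ⟨Ω.1, Ω.2.1⟩).2 u v)⟩
  map_add' _ _ := rfl
  map_smul' _ _ := rfl

/-- The localization map `Υ_{0x} : H¹(A, F₀) → H¹(L_x, F_{0x})`, `[Ω] ↦ [Ω|_{L_x}]`. -/
def localization₀ (x : M) : 𝔏.H1₀ →ₗ[ℝ] LieH1 (𝒜.adjointFiber x) (𝔏.F₀ x) :=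
  Submodule.mapQ _ _ (𝔏.restrict₀ x) (by
    rintro ⟨_, hΩ⟩ ⟨ν, hν, rfl⟩
    exact ⟨⟨𝔏.toFiber x (ν x), hν x⟩, LinearMap.ext fun u => Subtype.ext (𝔏.lie_eq u ν)⟩)

end LieAlgebroid.Representation

end Algebroid

end

/-! Let `L` be the adjoint bundle. If a cocycle `Ω` vanishes on all of `L`, the cocycle identity for
a section `a` of `A` and a section `w` of `L` reduces to `𝔏_w (Ω a) = 0`, because `[a, w]` again
lies in `L`; so `Ω` takes values in `F₀`. If moreover `Ω = 𝔡 μ`, then `𝔏_u μ = 0` on `L`, so `μ` is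
a section of `F₀`. The isomorphism of kernels therefore follows once information at `x` is spread
over `M`: an `F₀`-valued cocycle vanishing on `L_x` vanishes on `L` (injectivity), and a cocycle
which is a coboundary on `L_x` agrees on `L` with a global `𝔡 μ` (surjectivity).

Both are statements about linear relations. Take sections `w i` spanning `L` and a frame `f q` of
`F` near a point. Then `Ω` is a coboundary on `L_y` exactly when the columns `Ω (w i)`, `𝔏_{w i} (f
q)` have at `y` a linear relation whose coefficient at the first column is 1. The cocycle identity
and the morphism property of `𝔏` give a linear system for these columns under the operators `𝔏_a`.
In coordinates it reads `∂_v B = B Γ + C B` for the matrix `B` of columns, with `ℓ Γ = 0` for the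
functional `ℓ` reading the first coefficient. Hence `∂ + Γ` preserves the kernels of `B`, and `ℓ` is
constant along parallel sections of them: locally `ℓ` is either zero on all the kernels or takes the
value 1 on a smooth section.

`kernel_dichotomy` proves this by a Grönwall estimate along rays, and `relation_dichotomy` transfers
it to bundles. Connectedness makes the local alternative global, and a partition of unity glues the
local primitives, since the primitives at each point form an affine space. Only sections of `F` with
values in `F₀` enter; a local trivialization of `F₀` is never needed. -/

/-! ### Linear first order systems along rays -/

section Radial

open Filter Topology

variable {E : Type*} [NormedAddCommGroup E] [NormedSpace ℝ E]
  {V : Type*} [NormedAddCommGroup V] [NormedSpace ℝ V]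
  {P : Type*} [NormedAddCommGroup P] [NormedSpace ℝ P]
  {W : Type*} [NormedAddCommGroup W] [NormedSpace ℝ W]

/-- A function whose derivative is bounded by a multiple of its norm and which vanishes at a point
vanishes near that point. -/
theorem eventually_eq_zero_of_norm_fderiv_le {S : E → V} {z₀ : E} {K : ℝ}
    (hd : ∀ᶠ z in 𝓝 z₀, DifferentiableAt ℝ S z)
    (hb : ∀ᶠ z in 𝓝 z₀, ∀ v, ‖fderiv ℝ S z v‖ ≤ K * ‖v‖ * ‖S z‖) (h0 : S z₀ = 0) :
    ∀ᶠ z in 𝓝 z₀, S z = 0 := by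
  obtain ⟨r, hr, h⟩ := Metric.eventually_nhds_iff_ball.1 (hd.and hb)
  filter_upwards [Metric.ball_mem_nhds z₀ hr] with z hz
  -- Balls are star-shaped about their centre, so the estimate holds along the whole ray from `z₀`
  -- to `z`, and Grönwall's inequality applies to `S` along it.
  have hγ : ∀ t ∈ Set.Icc (0 : ℝ) 1, z₀ + t • (z - z₀) ∈ Metric.ball z₀ r := by
    intro t ht
    rw [mem_ball_iff_norm] at hz ⊢
    rw [add_sub_cancel_left, norm_smul, Real.norm_of_nonneg ht.1]
    exact (mul_le_of_le_one_left (norm_nonneg _) ht.2).trans_lt hz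
  have hder : ∀ t ∈ Set.Icc (0 : ℝ) 1, HasDerivAt (fun t : ℝ => S (z₀ + t • (z - z₀)))
      (fderiv ℝ S (z₀ + t • (z - z₀)) (z - z₀)) t := by
    intro t ht
    have h1 : HasDerivAt (fun t : ℝ => z₀ + t • (z - z₀)) (z - z₀) t := by
      simpa using ((hasDerivAt_id t).smul_const (z - z₀)).const_add z₀
    exact (h _ (hγ t ht)).1.hasFDerivAt.comp_hasDerivAt t h1
  have := eq_zero_of_abs_deriv_le_mul_abs_self_of_eq_zero_right (K := K * ‖z - z₀‖)
    (fun t ht => (hder t ht).continuousAt.continuousWithinAt)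
    (fun t ht => (hder t ⟨ht.1, ht.2.le⟩).hasDerivWithinAt) (by simpa using h0)
    (fun t ht => (h _ (hγ t ⟨ht.1, ht.2.le⟩)).2 _) 1 ⟨zero_le_one, le_rfl⟩
  simpa using this

theorem fderiv_clm_comp_apply' {G : Type*} [NormedAddCommGroup G] [NormedSpace ℝ G]
    {a : E → W →L[ℝ] G} {b : E → P →L[ℝ] W} {z : E} (ha : DifferentiableAt ℝ a z)
    (hb : DifferentiableAt ℝ b z) (v : E) (k : P) :
    fderiv ℝ (fun z => (a z).comp (b z)) z v k =
      fderiv ℝ a z v (b z k) + a z (fderiv ℝ b z v k) := by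
  rw [fderiv_clm_comp ha hb]
  simp [add_comm]

/-- Every linear map between finite dimensional spaces has a reflexive generalized inverse. -/
theorem exists_generalized_inverse [FiniteDimensional ℝ P] [FiniteDimensional ℝ W]
    (B : P →L[ℝ] W) :
    ∃ R : W →L[ℝ] P, (∀ k, B (R (B k)) = B k) ∧ ∀ w, R (B (R w)) = R w := by
  obtain ⟨g, hg⟩ := (B.toLinearMap.rangeRestrict).exists_rightInverse_of_surjective
    (LinearMap.range_rangeRestrict _)
  obtain ⟨g', hg'⟩ := LinearMap.exists_extend g
  have h : ∀ k, B (g' (B k)) = B k := by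
    intro k
    have h1 : g' (B k) = g (B.toLinearMap.rangeRestrict k) :=
      LinearMap.congr_fun hg' (B.toLinearMap.rangeRestrict k)
    rw [h1]
    exact congrArg Subtype.val (LinearMap.congr_fun hg (B.toLinearMap.rangeRestrict k))
  refine ⟨LinearMap.toContinuousLinearMap (g' ∘ₗ B.toLinearMap ∘ₗ g'), fun k => ?_, fun w => ?_⟩
  · simp [h]
  · simp [h]

theorem eventually_norm_le_of_continuousAt {X V : Type*} [TopologicalSpace X]
    [SeminormedAddCommGroup V] {f : X → V} {x : X}
    (hf : ContinuousAt f x) : ∃ K, 0 ≤ K ∧ ∀ᶠ y in 𝓝 x, ‖f y‖ ≤ K :=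
  ⟨‖f x‖ + 1, by positivity,
    (hf.norm.eventually (gt_mem_nhds (lt_add_one ‖f x‖))).mono fun _ h => h.le⟩

theorem eventually_norm_fderiv_le {f : E → V} {z₀ : E} (hf : ContDiffAt ℝ ∞ f z₀) :
    ∃ K, 0 ≤ K ∧ ∀ᶠ z in 𝓝 z₀, ‖fderiv ℝ f z‖ ≤ K :=
  eventually_norm_le_of_continuousAt (hf.fderiv_right (m := 0) (by simp)).continuousAt

variable [FiniteDimensional ℝ P] [FiniteDimensional ℝ W]

/-- A generalized inverse of `B z₀` extends smoothly to nearby points. -/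
theorem exists_smooth_generalized_inverse {z₀ : E} {B : E → P →L[ℝ] W}
    (hB : ∀ᶠ z in 𝓝 z₀, ContDiffAt ℝ ∞ B z) :
    ∃ R : E → W →L[ℝ] P, (∀ᶠ z in 𝓝 z₀, ContDiffAt ℝ ∞ R z) ∧
      (∀ᶠ z in 𝓝 z₀, ∀ w, R z (B z (R z w)) = R z w) ∧
      ∀ k, B z₀ (R z₀ (B z₀ k)) = B z₀ k := by
  obtain ⟨R₀, h1, h2⟩ := exists_generalized_inverse (B z₀)
  have : CompleteSpace P := FiniteDimensional.complete ℝ P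
  have : CompleteSpace W := FiniteDimensional.complete ℝ W
  -- Both `T` and `T'` are the identity at `z₀`, hence invertible nearby. The family is `T⁻¹ R₀`,
  -- which also equals `R₀ T'⁻¹` because `R₀ T' = T R₀`. With `T R₀ = R₀ B R₀` this gives `R B R =
  -- R` near `z₀`; the other identity `B R B = B` is obtained only at `z₀`.
  let T : E → P →L[ℝ] P := fun z => 1 + R₀.comp (B z - B z₀)
  let T' : E → W →L[ℝ] W := fun z => 1 + (B z - B z₀).comp R₀
  have hT : ∀ z, ContDiffAt ℝ ∞ B z → ContDiffAt ℝ ∞ T z := fun z hz =>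
    contDiffAt_const.add (contDiffAt_const.clm_comp (hz.sub contDiffAt_const))
  have hT' : ∀ z, ContDiffAt ℝ ∞ B z → ContDiffAt ℝ ∞ T' z := fun z hz =>
    contDiffAt_const.add ((hz.sub contDiffAt_const).clm_comp contDiffAt_const)
  have hU : ∀ᶠ z in 𝓝 z₀, IsUnit (T z) := by
    refine (hT z₀ hB.self_of_nhds).continuousAt.eventually (Units.isOpen.mem_nhds ?_)
    simp [T]
  have hU' : ∀ᶠ z in 𝓝 z₀, IsUnit (T' z) := by
    refine (hT' z₀ hB.self_of_nhds).continuousAt.eventually (Units.isOpen.mem_nhds ?_)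
    simp [T']
  refine ⟨fun z => (Ring.inverse (T z)).comp R₀, ?_, ?_, ?_⟩
  · filter_upwards [hB, hU] with z hz hu
    obtain ⟨u, hu⟩ := hu
    refine ContDiffAt.clm_comp ?_ contDiffAt_const
    exact ContDiffAt.comp (g := Ring.inverse) z (by rw [← hu]; exact contDiffAt_ringInverse ℝ u)
      (hT z hz)
  · filter_upwards [hU, hU'] with z hu hu' w
    have e1 : ∀ p, T z (Ring.inverse (T z) p) = p := fun p =>
      DFunLike.congr_fun (Ring.mul_inverse_cancel _ hu) p
    have e2 : ∀ p, Ring.inverse (T z) (T z p) = p := fun p =>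
      DFunLike.congr_fun (Ring.inverse_mul_cancel _ hu) p
    have e3 : ∀ p, T' z (Ring.inverse (T' z) p) = p := fun p =>
      DFunLike.congr_fun (Ring.mul_inverse_cancel _ hu') p
    have c1 : ∀ w, T z (R₀ w) = R₀ (B z (R₀ w)) := fun w => by simp [T, h2]
    have c2 : ∀ w, R₀ (T' z w) = T z (R₀ w) := fun w => by simp [T, T']
    have c3 : ∀ w, Ring.inverse (T z) (R₀ w) = R₀ (Ring.inverse (T' z) w) := fun w => by
      rw [← e2 (R₀ (Ring.inverse (T' z) w)), ← c2, e3]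
    change Ring.inverse (T z) (R₀ (B z (Ring.inverse (T z) (R₀ w)))) = Ring.inverse (T z) (R₀ w)
    congr 1
    rw [c3, ← c1, ← c2, e3]
  · intro k
    simp [T, h1]

/-- The kernels of a smooth family `B z` of linear maps satisfying the linear system
`∂_v B = B Γ + C B` form a subbundle; if `ℓ Γ = 0`, they are near `z₀` either all contained in the
kernel of `ℓ`, or have a smooth section on which `ℓ = 1`. -/
theorem kernel_dichotomy {z₀ : E} {B : E → P →L[ℝ] W} (ℓ : P →L[ℝ] ℝ) {K : ℝ}
    (hB : ∀ᶠ z in 𝓝 z₀, ContDiffAt ℝ ∞ B z)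
    (h : ∀ᶠ z in 𝓝 z₀, ∀ v, ∃ (Γ : P →L[ℝ] P) (C : W →L[ℝ] W), ‖Γ‖ ≤ K * ‖v‖ ∧ ‖C‖ ≤ K * ‖v‖ ∧
      (∀ k, ℓ (Γ k) = 0) ∧ ∀ k, fderiv ℝ B z v k = B z (Γ k) + C (B z k)) :
    (∀ᶠ z in 𝓝 z₀, ∀ k, B z k = 0 → ℓ k = 0) ∨
      ∃ k : E → P, (∀ᶠ z in 𝓝 z₀, ContDiffAt ℝ ∞ k z) ∧
        ∀ᶠ z in 𝓝 z₀, B z (k z) = 0 ∧ ℓ (k z) = 1 := by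
  obtain ⟨R, hR, hRB, hR0⟩ := exists_smooth_generalized_inverse hB
  -- `Q` fixes the kernel of `B`, and `S = B - B R B` measures its failure to map into that kernel.
  -- Showing `S = 0` near `z₀` amounts to showing that the rank of `B` does not jump.
  let Q : E → P →L[ℝ] P := fun z => ContinuousLinearMap.id ℝ P - (R z).comp (B z)
  let S : E → P →L[ℝ] W := fun z => (B z).comp (Q z)
  have hQ : ∀ᶠ z in 𝓝 z₀, ContDiffAt ℝ ∞ Q z := by
    filter_upwards [hB, hR] with z h1 h2 using contDiffAt_const.sub (h2.clm_comp h1)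
  have hS : ∀ᶠ z in 𝓝 z₀, ContDiffAt ℝ ∞ S z := by
    filter_upwards [hB, hQ] with z h1 h2 using h1.clm_comp h2
  have hRS : ∀ᶠ z in 𝓝 z₀, ∀ k, R z (S z k) = 0 := by
    filter_upwards [hRB] with z h1 k
    simp [S, Q, h1]
  have hS0 : S z₀ = 0 := by
    ext k
    simp [S, Q, hR0]
  have key : ∀ᶠ z in 𝓝 z₀, ∀ v (Γ : P →L[ℝ] P) (C : W →L[ℝ] W),
      (∀ k, fderiv ℝ B z v k = B z (Γ k) + C (B z k)) →
      ∀ k, fderiv ℝ S z v k = C (S z k) + B z (Γ (Q z k) + fderiv ℝ Q z v k) := by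
    filter_upwards [hB, hQ] with z hBz hQz v Γ C hΓ k
    change fderiv ℝ (fun z => (B z).comp (Q z)) z v k = _
    rw [fderiv_clm_comp_apply' (hBz.differentiableAt (by simp)) (hQz.differentiableAt (by simp)),
      hΓ, map_add]
    change B z _ + C (B z (Q z k)) + _ = C (B z (Q z k)) + _
    abel
  obtain ⟨KR', hKR'0, hKR'⟩ := eventually_norm_fderiv_le hR.self_of_nhds
  obtain ⟨KQ', hKQ'0, hKQ'⟩ := eventually_norm_fderiv_le hQ.self_of_nhds
  obtain ⟨KR, hKR0, hKR⟩ := eventually_norm_le_of_continuousAt hR.self_of_nhds.continuousAt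
  obtain ⟨KQ, hKQ0, hKQ⟩ := eventually_norm_le_of_continuousAt hQ.self_of_nhds.continuousAt
  obtain ⟨KB, hKB0, hKB⟩ := eventually_norm_le_of_continuousAt hB.self_of_nhds.continuousAt
  have hS_zero : ∀ᶠ z in 𝓝 z₀, S z = 0 := by
    refine eventually_eq_zero_of_norm_fderiv_le (hS.mono fun z hz => hz.differentiableAt (by simp))
      -- The summands bound the factors accompanying `S` in the four terms `C S`, `S N`, `B (∂R) S`
      -- and `B R C S` of the formula `hfd`.
      (K := K + (K * KQ + KQ') + (KB * KR' + KB * KR * K)) ?_ hS0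
    filter_upwards [key, h, hS, hR, hRS.eventually_nhds, hKR', hKQ', hKR, hKQ, hKB] with
      z key h hSz hRz hRSz hKR' hKQ' hKR hKQ hKB v
    obtain ⟨Γ, C, hΓ, hC, -, hBz⟩ := h v
    -- `K` is not assumed nonnegative; the sign needed to multiply estimates comes from the bound on
    -- `Γ`.
    have hKv : 0 ≤ K * ‖v‖ := (norm_nonneg _).trans hΓ
    have key := key v Γ C hBz
    set N : P →L[ℝ] P := Γ.comp (Q z) + fderiv ℝ Q z v with hN
    have hNb : ‖N‖ ≤ (K * KQ + KQ') * ‖v‖ := by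
      calc ‖N‖ ≤ ‖Γ‖ * ‖Q z‖ + ‖fderiv ℝ Q z‖ * ‖v‖ := (norm_add_le _ _).trans
            (add_le_add (ContinuousLinearMap.opNorm_comp_le _ _) (ContinuousLinearMap.le_opNorm _ _))
        _ ≤ (K * ‖v‖) * KQ + KQ' * ‖v‖ := by gcongr
        _ = _ := by ring
    -- Differentiating `R S = 0` controls the component of `B N` not already expressed by `S`: since
    -- `B = S + B R B`, only `R B N = R (∂S - C S)` remains, and this too is linear in `S`.
    have hRS' : ∀ k, R z (fderiv ℝ S z v k) = - fderiv ℝ R z v (S z k) := by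
      intro k
      have e : fderiv ℝ (fun z => (R z).comp (S z)) z = 0 := by
        have : (fun z => (R z).comp (S z)) =ᶠ[𝓝 z] fun _ => 0 := by
          filter_upwards [hRSz] with y hy
          ext k
          simp [hy k]
        rw [this.fderiv_eq]
        simp
      have e' := fderiv_clm_comp_apply' (hRz.differentiableAt (by simp))
        (hSz.differentiableAt (by simp)) v k
      rw [e] at e'
      exact eq_neg_of_add_eq_zero_right e'.symm
    have hfd : fderiv ℝ S z v = C.comp (S z) + (S z).comp N -
        ((B z).comp ((fderiv ℝ R z v).comp (S z)) + (B z).comp ((R z).comp (C.comp (S z)))) := by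
      ext k
      have e1 : fderiv ℝ S z v k = C (S z k) + B z (N k) := key k
      have e2 : B z (N k) = S z (N k) + B z (R z (B z (N k))) := by simp [S, Q]
      have e3 : R z (B z (N k)) = - fderiv ℝ R z v (S z k) - R z (C (S z k)) := by
        rw [← hRS', e1, map_add]
        abel
      rw [e1, e2, e3]
      simp only [map_sub, map_neg, sub_apply, add_apply, ContinuousLinearMap.comp_apply]
      abel
    have hR'v : ‖fderiv ℝ R z v‖ ≤ KR' * ‖v‖ :=
      (ContinuousLinearMap.le_opNorm _ _).trans (by gcongr)
    rw [hfd]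
    calc _ ≤ (‖C‖ * ‖S z‖ + ‖S z‖ * ‖N‖) +
          (‖B z‖ * (‖fderiv ℝ R z v‖ * ‖S z‖) + ‖B z‖ * (‖R z‖ * (‖C‖ * ‖S z‖))) := by
          refine (norm_sub_le _ _).trans (add_le_add ((norm_add_le _ _).trans (add_le_add
            (ContinuousLinearMap.opNorm_comp_le _ _) (ContinuousLinearMap.opNorm_comp_le _ _)))
            ((norm_add_le _ _).trans (add_le_add ?_ ?_)))
          · exact (ContinuousLinearMap.opNorm_comp_le _ _).trans (mul_le_mul_of_nonneg_left
              (ContinuousLinearMap.opNorm_comp_le _ _) (norm_nonneg _))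
          · exact (ContinuousLinearMap.opNorm_comp_le _ _).trans (mul_le_mul_of_nonneg_left
              ((ContinuousLinearMap.opNorm_comp_le _ _).trans (mul_le_mul_of_nonneg_left
                (ContinuousLinearMap.opNorm_comp_le _ _) (norm_nonneg _))) (norm_nonneg _))
      _ ≤ ((K * ‖v‖) * ‖S z‖ + ‖S z‖ * ((K * KQ + KQ') * ‖v‖)) +
          (KB * ((KR' * ‖v‖) * ‖S z‖) + KB * (KR * ((K * ‖v‖) * ‖S z‖))) := by gcongr
      _ = _ := by ring
  -- Now that `Q` projects onto the kernel of `B`, `Λ` represents `ℓ` on that kernel.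
  let Λ : E → P →L[ℝ] ℝ := fun z => ℓ.comp (Q z)
  have hΛ : ∀ᶠ z in 𝓝 z₀, ContDiffAt ℝ ∞ Λ z := by
    filter_upwards [hQ] with z h2 using contDiffAt_const.clm_comp h2
  have hBQ : ∀ᶠ z in 𝓝 z₀, ∀ k, B z (Q z k) = 0 := by
    filter_upwards [hS_zero] with z hz k using DFunLike.congr_fun hz k
  by_cases h0 : Λ z₀ = 0
  · left
    have : ∀ᶠ z in 𝓝 z₀, Λ z = 0 := by
      refine eventually_eq_zero_of_norm_fderiv_le
        (hΛ.mono fun z hz => hz.differentiableAt (by simp)) (K := K * KQ + KQ') ?_ h0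
      filter_upwards [key, h, hQ, hS_zero.eventually_nhds, hKQ', hKQ] with
        z key h hQz hSz hKQ' hKQ v
      obtain ⟨Γ, C, hΓ, hC, hℓ, hBz⟩ := h v
      have key := key v Γ C hBz
      have hKv : 0 ≤ K * ‖v‖ := (norm_nonneg _).trans hΓ
      set N : P →L[ℝ] P := Γ.comp (Q z) + fderiv ℝ Q z v with hN
      have hNb : ‖N‖ ≤ (K * KQ + KQ') * ‖v‖ := by
        calc ‖N‖ ≤ ‖Γ‖ * ‖Q z‖ + ‖fderiv ℝ Q z‖ * ‖v‖ := (norm_add_le _ _).trans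
              (add_le_add (ContinuousLinearMap.opNorm_comp_le _ _)
                (ContinuousLinearMap.le_opNorm _ _))
          _ ≤ (K * ‖v‖) * KQ + KQ' * ‖v‖ := by gcongr
          _ = _ := by ring
      have hS' : fderiv ℝ S z = 0 := by
        rw [Filter.EventuallyEq.fderiv_eq (f₁ := S) (f := fun _ => 0) hSz]
        simp
      -- With `S = 0` nearby, `key` says that `N` maps into the kernel of `B`, so `Q N = N`. As `ℓ Γ
      -- = 0`, `∂Λ = ℓ ∂Q = ℓ N = Λ N`, again a linear equation to which Grönwall applies.
      have hfd : fderiv ℝ Λ z v = (Λ z).comp N := by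
        ext k
        have e1 : B z (N k) = 0 := by
          have := key k
          rw [hS', hSz.self_of_nhds] at this
          simpa [N] using this.symm
        have e2 : Q z (N k) = N k := by simp [Q, e1]
        change fderiv ℝ (fun z => ℓ.comp (Q z)) z v k = ℓ (Q z (N k))
        rw [fderiv_clm_comp_apply' (differentiableAt_const _) (hQz.differentiableAt (by simp)), e2]
        simp [N, hℓ]
      rw [hfd]
      refine (ContinuousLinearMap.opNorm_comp_le _ _).trans ?_
      rw [mul_comm]
      gcongr
    filter_upwards [this] with z hz k hk
    have := DFunLike.congr_fun hz k
    simpa [Λ, Q, hk] using this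
  · right
    obtain ⟨k₀, hk₀⟩ : ∃ k₀, Λ z₀ k₀ ≠ 0 := by
      by_contra! hne
      exact h0 (ContinuousLinearMap.ext hne)
    have hne : ∀ᶠ z in 𝓝 z₀, Λ z k₀ ≠ 0 :=
      (hΛ.self_of_nhds.continuousAt.clm_apply continuousAt_const).eventually_ne hk₀
    -- The projection of the constant vector `k₀` to the kernels, rescaled so that `ℓ` equals 1.
    refine ⟨fun z => (Λ z k₀)⁻¹ • Q z k₀, ?_, ?_⟩
    · filter_upwards [hΛ, hQ, hne] with z h1 h2 h3
      exact ((h1.clm_apply contDiffAt_const).inv h3).smul (h2.clm_apply contDiffAt_const)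
    · filter_upwards [hBQ, hne] with z h1 h2
      refine ⟨by simp [h1], ?_⟩
      rw [map_smul, smul_eq_mul]
      exact inv_mul_cancel₀ h2

end Radial

/-! ### Coefficients with respect to sections which span a fibre -/

section Coefficients

open Filter Topology

variable {E : Type*} [NormedAddCommGroup E] [NormedSpace ℝ E]
  {M : Type*} [TopologicalSpace M] [ChartedSpace E M]
  {FV : Type*} [NormedAddCommGroup FV] [NormedSpace ℝ FV] [FiniteDimensional ℝ FV]
  {V : M → Type*} [TopologicalSpace (TotalSpace FV V)]
  [∀ x, AddCommGroup (V x)] [∀ x, Module ℝ (V x)] [∀ x, TopologicalSpace (V x)]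
  [FiberBundle FV V] [VectorBundle ℝ FV V] [ContMDiffVectorBundle ∞ FV V 𝓘(ℝ, E)]
  {ι : Type*} [Fintype ι]

/-- Smooth sections which span the fibre over `y₀` span the nearby fibres, with coefficients
which depend smoothly on the base point. -/
theorem SmoothSection.exists_local_coeff (s : ι → SmoothSection E FV V) (y₀ : M)
    (hs : ⊤ ≤ Submodule.span ℝ (Set.range fun i => s i y₀)) :
    ∃ D : M → FV →L[ℝ] (ι → ℝ),
      (∀ᶠ y in 𝓝 y₀, ContMDiffAt 𝓘(ℝ, E) 𝓘(ℝ, FV →L[ℝ] (ι → ℝ)) ∞ D y) ∧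
      (∀ᶠ y in 𝓝 y₀, ∀ u : V y,
        ∑ i, D y ((trivializationAt FV V y₀).continuousLinearMapAt ℝ y u) i • s i y = u) ∧
      (LinearIndependent ℝ (fun i => s i y₀) → ∀ᶠ y in 𝓝 y₀, ∀ c : ι → ℝ,
        D y ((trivializationAt FV V y₀).continuousLinearMapAt ℝ y (∑ i, c i • s i y)) = c) := by
  classical
  set e := trivializationAt FV V y₀
  have he : ∀ᶠ y in 𝓝 y₀, y ∈ e.baseSet :=
    e.open_baseSet.mem_nhds (mem_baseSet_trivializationAt FV V y₀)
  have hy₀ : y₀ ∈ e.baseSet := mem_baseSet_trivializationAt FV V y₀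
  let J : M → (ι → ℝ) →L[ℝ] FV := fun y =>
    ∑ i, ContinuousLinearMap.smulRightL ℝ (ι → ℝ) FV (ContinuousLinearMap.proj i) (e ⟨y, s i y⟩).2
  have hJ : ∀ y ∈ e.baseSet, ContMDiffAt 𝓘(ℝ, E) 𝓘(ℝ, (ι → ℝ) →L[ℝ] FV) ∞ J y := by
    intro y hy
    refine ContMDiffAt.sum fun i _ => ?_
    exact (ContinuousLinearMap.contMDiff _).contMDiffAt.comp y
      ((e.contMDiffAt_section_iff hy).1 (s i).contMDiff.contMDiffAt)
  have hJe : ∀ y ∈ e.baseSet, ∀ c, J y c = e.continuousLinearMapAt ℝ y (∑ i, c i • s i y) := by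
    intro y hy c
    simp [J, e.coe_linearMapAt_of_mem (R := ℝ) hy]
  have hinj : ∀ y ∈ e.baseSet, Function.Injective (e.continuousLinearMapAt ℝ y) := fun y hy =>
    Function.LeftInverse.injective fun u => e.symmL_continuousLinearMapAt hy u
  have hsurj : Function.Surjective (J y₀).toLinearMap := by
    intro v
    obtain ⟨c, hc⟩ := (Submodule.mem_span_range_iff_exists_fun ℝ).1
      (hs (Submodule.mem_top (x := e.symmL ℝ y₀ v)))
    refine ⟨c, ?_⟩
    rw [ContinuousLinearMap.coe_coe, hJe y₀ hy₀, hc]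
    exact e.continuousLinearMapAt_symmL hy₀ v
  obtain ⟨T', hT'⟩ := (J y₀).toLinearMap.exists_rightInverse_of_surjective
    (LinearMap.range_eq_top.2 hsurj)
  set T : FV →L[ℝ] (ι → ℝ) := LinearMap.toContinuousLinearMap T'
  have := FiniteDimensional.complete ℝ FV
  -- `T` is a right inverse of `J` at `y₀` only. Correcting it by `G⁻¹` gives the right inverse `T
  -- G⁻¹` of `J y` for nearby `y`.
  let G : M → FV →L[ℝ] FV := fun y => (J y).comp T
  have hG : ∀ y ∈ e.baseSet, ContMDiffAt 𝓘(ℝ, E) 𝓘(ℝ, FV →L[ℝ] FV) ∞ G y :=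
    fun y hy => (hJ y hy).clm_comp contMDiffAt_const
  have hG0 : G y₀ = 1 := by
    ext t
    exact LinearMap.congr_fun hT' t
  have hU : ∀ᶠ y in 𝓝 y₀, IsUnit (G y) :=
    (hG y₀ hy₀).continuousAt.eventually (Units.isOpen.mem_nhds (by rw [hG0]; exact isUnit_one))
  refine ⟨fun y => T.comp (Ring.inverse (G y)), ?_, ?_, fun hli => ?_⟩
  · filter_upwards [he, hU] with y hy ⟨g, hg⟩
    refine contMDiffAt_const.clm_comp ?_
    exact ContMDiffAt.comp (g := Ring.inverse) y
      (by rw [← hg]; exact (contDiffAt_ringInverse ℝ g).contMDiffAt) (hG y hy)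
  · filter_upwards [he, hU] with y hy hg u
    apply hinj y hy
    rw [← hJe y hy]
    exact DFunLike.congr_fun (Ring.mul_inverse_cancel _ hg) _
  · have hJinj : Function.Injective (J y₀).toLinearMap := by
      rw [← LinearMap.ker_eq_bot, LinearMap.ker_eq_bot']
      intro c hc
      rw [ContinuousLinearMap.coe_coe, hJe y₀ hy₀, map_eq_zero_iff _ (hinj y₀ hy₀)] at hc
      exact funext (Fintype.linearIndependent_iff.1 hli c hc)
    -- If `J y₀` is bijective then so is `T`, and `T G⁻¹ J T = T` turns the right inverse into a
    -- two-sided one.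
    have hTs : Function.Surjective T := fun c =>
      ⟨J y₀ c, hJinj (LinearMap.congr_fun hT' (J y₀ c))⟩
    filter_upwards [he, hU] with y hy hg c
    obtain ⟨v, rfl⟩ := hTs c
    rw [← hJe y hy]
    exact congrArg T (DFunLike.congr_fun (Ring.inverse_mul_cancel _ hg) v)

/-- The coefficients of a smooth section are smooth. -/
theorem SmoothSection.contMDiffAt_coeff {W : Type*} [NormedAddCommGroup W] [NormedSpace ℝ W]
    {D : M → FV →L[ℝ] W} {y₀ y : M}
    (hD : ContMDiffAt 𝓘(ℝ, E) 𝓘(ℝ, FV →L[ℝ] W) ∞ D y)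
    (hy : y ∈ (trivializationAt FV V y₀).baseSet) (t : SmoothSection E FV V) :
    ContMDiffAt 𝓘(ℝ, E) 𝓘(ℝ, W) ∞
      (fun y => D y ((trivializationAt FV V y₀).continuousLinearMapAt ℝ y (t y))) y := by
  set e := trivializationAt FV V y₀
  refine hD.clm_apply (((e.contMDiffAt_section_iff hy).1 t.contMDiff.contMDiffAt
    ).congr_of_eventuallyEq ?_)
  filter_upwards [e.open_baseSet.mem_nhds hy] with z hz
  exact congrFun (e.coe_linearMapAt_of_mem (R := ℝ) hz) (t z)

end Coefficients

/-! ### Transfer of the kernel alternative from a vector space to a manifold. -/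

section KernelManifold

open Filter Topology

variable {E : Type*} [NormedAddCommGroup E] [NormedSpace ℝ E] [FiniteDimensional ℝ E]
  {M : Type*} [TopologicalSpace M] [ChartedSpace E M] [IsManifold 𝓘(ℝ, E) ∞ M]
  {P : Type*} [NormedAddCommGroup P] [NormedSpace ℝ P] [FiniteDimensional ℝ P]
  {W : Type*} [NormedAddCommGroup W] [NormedSpace ℝ W] [FiniteDimensional ℝ W]
  {κ : Type*} [Fintype κ]

/-- The derivative of a vector valued function along a tangent vector. -/
noncomputable def vectorDeriv (f : M → W) (y : M) : TangentSpace 𝓘(ℝ, E) y →L[ℝ] W :=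
  mfderiv 𝓘(ℝ, E) 𝓘(ℝ, W) f y

/-- The version of `kernel_dichotomy` on a manifold, with the linear system given along vector
fields which span the tangent space at `y₀`. -/
theorem kernel_dichotomy_manifold {y₀ : M} {B : M → P →L[ℝ] W} (ℓ : P →L[ℝ] ℝ)
    (hB : ∀ᶠ y in 𝓝 y₀, ContMDiffAt 𝓘(ℝ, E) 𝓘(ℝ, P →L[ℝ] W) ∞ B y)
    (X : κ → SmoothSection E E (TangentSpace 𝓘(ℝ, E) (M := M)))
    (hX : ⊤ ≤ Submodule.span ℝ (Set.range fun j => X j y₀))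
    {Γ : κ → M → P →L[ℝ] P} {C : κ → M → W →L[ℝ] W}
    (hΓ : ∀ j, ContinuousAt (Γ j) y₀) (hC : ∀ j, ContinuousAt (C j) y₀)
    (hℓ : ∀ᶠ y in 𝓝 y₀, ∀ j k, ℓ (Γ j y k) = 0)
    (h : ∀ᶠ y in 𝓝 y₀, ∀ j k, vectorDeriv (fun z => B z k) y (X j y) =
      B y (Γ j y k) + C j y (B y k)) :
    (∀ᶠ y in 𝓝 y₀, ∀ k, B y k = 0 → ℓ k = 0) ∨
      ∃ k : M → P, (∀ᶠ y in 𝓝 y₀, ContMDiffAt 𝓘(ℝ, E) 𝓘(ℝ, P) ∞ k y) ∧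
        ∀ᶠ y in 𝓝 y₀, B y (k y) = 0 ∧ ℓ (k y) = 1 := by
  obtain ⟨D, hD, hDX, -⟩ := SmoothSection.exists_local_coeff X y₀ hX
  set eT := trivializationAt E (TangentSpace 𝓘(ℝ, E) (M := M)) y₀
  set φ := extChartAt 𝓘(ℝ, E) y₀ with hφ
  set z₀ := φ y₀ with hz₀
  have hz₀' : φ.symm z₀ = y₀ := extChartAt_to_inv y₀
  have htgt : ∀ᶠ z in 𝓝 z₀, z ∈ φ.target := extChartAt_target_mem_nhds y₀
  have hcs : Tendsto φ.symm (𝓝 z₀) (𝓝 y₀) := by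
    have := continuousAt_extChartAt_symm (I := 𝓘(ℝ, E)) y₀
    rwa [ContinuousAt, hz₀'] at this
  have hφs : ∀ᶠ z in 𝓝 z₀, ContMDiffAt 𝓘(ℝ, E) 𝓘(ℝ, E) ∞ φ.symm z := by
    filter_upwards [htgt] with z hz
    exact (contMDiffOn_extChartAt_symm (n := ∞) y₀).contMDiffAt
      ((isOpen_extChartAt_target y₀).mem_nhds hz)
  have hdB : ∀ᶠ z in 𝓝 z₀, ∀ v k, fderiv ℝ (B ∘ φ.symm) z v k =
      ∑ j, D (φ.symm z) v j • vectorDeriv (fun y => B y k) (φ.symm z) (X j (φ.symm z)) := by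
    filter_upwards [htgt, hφs, hcs.eventually hB, hcs.eventually hDX] with z hz hφz hBz hDXz v k
    have hsrc : φ.symm z ∈ φ.source := φ.map_target hz
    have hdk : MDifferentiableAt 𝓘(ℝ, E) 𝓘(ℝ, W) (fun y => B y k) (φ.symm z) :=
      (hBz.clm_apply contMDiffAt_const).mdifferentiableAt (by simp)
    have e1 : fderiv ℝ (B ∘ φ.symm) z v k = fderiv ℝ (fun z => B (φ.symm z) k) z v := by
      have hd := ((ContMDiffAt.comp z hBz hφz).contDiffAt).differentiableAt (by simp)
      have := (hd.hasFDerivAt.clm_apply (hasFDerivAt_const k z)).fderiv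
      simp only [Function.comp_apply] at this
      rw [this]
      simp
    have e2 : fderiv ℝ (fun z => B (φ.symm z) k) z v =
        vectorDeriv (fun y => B y k) (φ.symm z) (mfderiv 𝓘(ℝ, E) 𝓘(ℝ, E) φ.symm z v) := by
      have := mfderiv_comp z hdk (hφz.mdifferentiableAt (by simp))
      rw [← mfderiv_eq_fderiv]
      exact DFunLike.congr_fun this v
    -- The trivialization of the tangent bundle at `y₀` is the differential of the chart `φ`, so it
    -- undoes the differential of `φ.symm`. The coefficients of a coordinate vector `v` in terms of
    -- the fields `X j` are thus `D v`.
    have e3 : eT.continuousLinearMapAt ℝ (φ.symm z) (mfderiv 𝓘(ℝ, E) 𝓘(ℝ, E) φ.symm z v) = v := by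
      have h1 := mfderiv_extChartAt_comp_mfderivWithin_extChartAt_symm (I := 𝓘(ℝ, E)) hz
      rw [modelWithCornersSelf_coe, Set.range_id, mfderivWithin_univ] at h1
      rw [TangentBundle.continuousLinearMapAt_trivializationAt (by simpa [hφ] using hsrc)]
      exact DFunLike.congr_fun h1 v
    rw [e1, e2]
    conv_lhs => rw [← hDXz (mfderiv 𝓘(ℝ, E) 𝓘(ℝ, E) φ.symm z v)]
    rw [map_sum, e3]
    simp only [map_smul]
  obtain ⟨KD, hKD0, hKD⟩ := eventually_norm_le_of_continuousAt hD.self_of_nhds.continuousAt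
  choose KΓ hKΓ0 hKΓ using fun j => eventually_norm_le_of_continuousAt (hΓ j)
  choose KC hKC0 hKC using fun j => eventually_norm_le_of_continuousAt (hC j)
  have key := kernel_dichotomy (z₀ := z₀) (B := B ∘ φ.symm) ℓ
    -- A single constant serving for both `∑ D_j(v) Γ j` and `∑ D_j(v) C j`.
    (K := ∑ j, KD * (KΓ j + KC j)) ?_ ?_
  · have hsrc : ∀ᶠ y in 𝓝 y₀, y ∈ φ.source := extChartAt_source_mem_nhds y₀
    have hc : Tendsto φ (𝓝 y₀) (𝓝 z₀) := continuousAt_extChartAt y₀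
    refine key.imp (fun h => ?_) ?_
    · filter_upwards [hc.eventually h, hsrc] with y hy hys
      simpa [φ.left_inv hys] using hy
    · rintro ⟨k, hk, hk1⟩
      refine ⟨k ∘ φ, ?_, ?_⟩
      · filter_upwards [hc.eventually hk, hsrc] with y hy hys
        exact hy.contMDiffAt.comp y (contMDiffAt_extChartAt' (by simpa [hφ] using hys))
      · filter_upwards [hc.eventually hk1, hsrc] with y hy hys
        simpa [φ.left_inv hys] using hy
  · filter_upwards [hφs, hcs.eventually hB] with z h1 h2
    exact (ContMDiffAt.comp z h2 h1).contDiffAt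
  · filter_upwards [hdB, hcs.eventually h, hcs.eventually hℓ, hcs.eventually hKD,
      hcs.eventually (eventually_all.2 hKΓ), hcs.eventually (eventually_all.2 hKC)] with
      z hdB h hℓ hKD hKΓ hKC v
    have hDv : ∀ j, ‖D (φ.symm z) v j‖ ≤ KD * ‖v‖ := fun j =>
      (norm_le_pi_norm _ j).trans ((ContinuousLinearMap.le_opNorm _ _).trans (by gcongr))
    refine ⟨∑ j, D (φ.symm z) v j • Γ j (φ.symm z), ∑ j, D (φ.symm z) v j • C j (φ.symm z),
      ?_, ?_, fun k => ?_, fun k => ?_⟩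
    · rw [Finset.sum_mul]
      refine norm_sum_le_of_le _ fun j _ => ?_
      rw [norm_smul]
      calc _ ≤ (KD * ‖v‖) * KΓ j := by gcongr; exacts [hDv j, hKΓ j]
        _ ≤ (KD * ‖v‖) * (KΓ j + KC j) := by gcongr; linarith [hKC0 j]
        _ = _ := by ring
    · rw [Finset.sum_mul]
      refine norm_sum_le_of_le _ fun j _ => ?_
      rw [norm_smul]
      calc _ ≤ (KD * ‖v‖) * KC j := by gcongr; exacts [hDv j, hKC j]
        _ ≤ (KD * ‖v‖) * (KΓ j + KC j) := by gcongr; linarith [hKΓ0 j]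
        _ = _ := by ring
    · simp [hℓ]
    · rw [hdB]
      simp only [h, sum_apply, map_sum, smul_apply, map_smul,
        ← Finset.sum_add_distrib, smul_add]
      rfl

end KernelManifold

/-! ### Coefficients in local frames and covariant derivatives. -/

section LocalFrames

open Filter Topology

variable {E : Type*} [NormedAddCommGroup E] [NormedSpace ℝ E]
  {M : Type*} [TopologicalSpace M] [ChartedSpace E M]
  {FV : Type*} [NormedAddCommGroup FV] [NormedSpace ℝ FV] [FiniteDimensional ℝ FV]
  {V : M → Type*} [TopologicalSpace (TotalSpace FV V)]
  [∀ x, AddCommGroup (V x)] [∀ x, Module ℝ (V x)] [∀ x, TopologicalSpace (V x)]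
  [FiberBundle FV V] [VectorBundle ℝ FV V] [ContMDiffVectorBundle ∞ FV V 𝓘(ℝ, E)]
  {ι : Type*} [Fintype ι]

/-- Fibrewise linear maps which, near `y₀`, express each vector as a combination of the sections
`s i`, with coefficients which are smooth for smooth sections. -/
structure IsCoeffNear (s : ι → SmoothSection E FV V) (y₀ : M) (c : ∀ y, V y →ₗ[ℝ] (ι → ℝ)) :
    Prop where
  contMDiffAt : ∀ᶠ y in 𝓝 y₀, ∀ t : SmoothSection E FV V,
    ContMDiffAt 𝓘(ℝ, E) 𝓘(ℝ, ι → ℝ) ∞ (fun z => c z (t z)) y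
  sum_smul : ∀ᶠ y in 𝓝 y₀, ∀ u : V y, ∑ i, c y u i • s i y = u

/-- Composing the coefficient map with the trivialization at `y₀` makes it a map on the fibres
themselves, so that later arguments need no trivialization. -/
theorem SmoothSection.exists_isCoeffNear (s : ι → SmoothSection E FV V) (y₀ : M)
    (hs : ⊤ ≤ Submodule.span ℝ (Set.range fun i => s i y₀)) :
    ∃ c : ∀ y, V y →ₗ[ℝ] (ι → ℝ), IsCoeffNear s y₀ c ∧
      (LinearIndependent ℝ (fun i => s i y₀) →
        ∀ᶠ y in 𝓝 y₀, ∀ k : ι → ℝ, c y (∑ i, k i • s i y) = k) := by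
  obtain ⟨D, hD, h1, h2⟩ := SmoothSection.exists_local_coeff s y₀ hs
  refine ⟨fun y => (D y).toLinearMap ∘ₗ
    ((trivializationAt FV V y₀).continuousLinearMapAt ℝ y).toLinearMap, ⟨?_, h1⟩, h2⟩
  filter_upwards [hD, (trivializationAt FV V y₀).open_baseSet.mem_nhds
    (mem_baseSet_trivializationAt FV V y₀)] with y hy hyb t
  exact SmoothSection.contMDiffAt_coeff hy hyb t

variable [FiniteDimensional ℝ E] [T2Space M] [IsManifold 𝓘(ℝ, E) ∞ M]

/-- A function which is smooth near a point agrees near it with a global smooth function. -/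
theorem exists_contMDiffMap_eventuallyEq {g : M → ℝ} {y : M}
    (hg : ∀ᶠ z in 𝓝 y, ContMDiffAt 𝓘(ℝ, E) 𝓘(ℝ, ℝ) ∞ g z) :
    ∃ g' : C^∞⟮𝓘(ℝ, E), M; ℝ⟯, ∀ᶠ z in 𝓝 y, g' z = g z := by
  obtain ⟨ψ, h1, h2⟩ := exists_smooth_cutoff (E := E) hg
  refine ⟨⟨fun z => ψ z * g z, ?_⟩, ?_⟩
  · apply contMDiff_of_tsupport
    intro z hz
    exact ψ.contMDiff.contMDiffAt.mul
      (interior_subset (h2 (tsupport_mul_subset_left hz)) : ContMDiffAt _ _ _ g z)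
  · filter_upwards [h1] with z hz
    change ψ z * g z = g z
    rw [hz, one_mul]

theorem vectorDeriv_congr {W : Type*} [NormedAddCommGroup W] [NormedSpace ℝ W] {f g : M → W}
    {y : M} (h : f =ᶠ[𝓝 y] g) (X : TangentSpace 𝓘(ℝ, E) y) :
    vectorDeriv f y X = vectorDeriv g y X := by
  have := h.mfderiv_eq (I := 𝓘(ℝ, E)) (I' := 𝓘(ℝ, W))
  exact DFunLike.congr_fun this X

theorem vectorDeriv_clm_comp {W W' : Type*} [NormedAddCommGroup W] [NormedSpace ℝ W]
    [NormedAddCommGroup W'] [NormedSpace ℝ W'] (L : W →L[ℝ] W') {f : M → W} {y : M}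
    (hf : MDifferentiableAt 𝓘(ℝ, E) 𝓘(ℝ, W) f y) (X : TangentSpace 𝓘(ℝ, E) y) :
    vectorDeriv (fun z => L (f z)) y X = L (vectorDeriv f y X) := by
  have h1 := mfderiv_comp y (L.mdifferentiableAt (x := f y)) hf
  have h2 := DFunLike.congr_fun h1 X
  rw [L.mfderiv_eq] at h2
  exact h2

theorem SmoothSection.sum_apply {α : Type*} (u : Finset α) (s : α → SmoothSection E FV V) (y : M) :
    (∑ i ∈ u, s i) y = ∑ i ∈ u, s i y := by
  rw [← ContMDiffSection.coeAddHom_apply, map_sum, Finset.sum_apply]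
  rfl

variable [∀ x, IsTopologicalAddGroup (V x)] [∀ x, ContinuousSMul ℝ (V x)]

/-- Covariant differential operators are local. -/
theorem IsCovariantDiffOp.congr {y : M} {X : TangentSpace 𝓘(ℝ, E) y}
    {D : SmoothSection E FV V →ₗ[ℝ] V y} (hD : IsCovariantDiffOp X D)
    {μ ν : SmoothSection E FV V} (h : ∀ᶠ z in 𝓝 y, μ z = ν z) : D μ = D ν := by
  rw [← sub_eq_zero, ← map_sub]
  obtain ⟨ψ, h1, h2⟩ := exists_smooth_cutoff (E := E) h
  have e : SmoothSection.fmul ψ (μ - ν) = 0 := by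
    ext z
    by_cases hz : z ∈ tsupport ψ
    · have : z ∈ {z | μ z = ν z} := interior_subset (h2 hz)
      replace this : μ z = ν z := this
      simp [this]
    · simp [image_eq_zero_of_notMem_tsupport hz]
  have := hD ψ (μ - ν)
  rw [e, map_zero, h1.self_of_nhds] at this
  simpa [h.self_of_nhds] using this.symm

/-- The derivative of the coefficients of a section with respect to a local frame, in terms of a
covariant differential operator. -/
theorem IsCoeffNear.vectorDeriv_eq {s : ι → SmoothSection E FV V} {y₀ : M}
    {c : ∀ y, V y →ₗ[ℝ] (ι → ℝ)} (hc : IsCoeffNear s y₀ c)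
    (hli : ∀ᶠ y in 𝓝 y₀, ∀ k : ι → ℝ, c y (∑ i, k i • s i y) = k) :
    ∀ᶠ y in 𝓝 y₀, ∀ (X : TangentSpace 𝓘(ℝ, E) y) (D : SmoothSection E FV V →ₗ[ℝ] V y),
      IsCovariantDiffOp X D → ∀ μ : SmoothSection E FV V,
        vectorDeriv (fun z => c z (μ z)) y X = c y (D μ) - ∑ i, c y (μ y) i • c y (D (s i)) := by
  filter_upwards [hc.contMDiffAt.eventually_nhds, hc.sum_smul.eventually_nhds, hli] with
    y h1 h2 h3 X D hD μ
  have hg : ∀ i, ∀ᶠ z in 𝓝 y, ContMDiffAt 𝓘(ℝ, E) 𝓘(ℝ, ℝ) ∞ (fun z => c z (μ z) i) z :=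
    fun i => h1.mono fun z hz => contMDiffAt_pi_space.1 (hz μ) i
  choose g hg' using fun i => exists_contMDiffMap_eventuallyEq (hg i)
  -- The coefficients are smooth only near `y`. Replacing them by global functions `g i` with the
  -- same germs is harmless because `D` is local, and makes the Leibniz rule available.
  have hμ : D μ = D (∑ i, SmoothSection.fmul (g i) (s i)) := by
    refine hD.congr ?_
    filter_upwards [h2, eventually_all.2 hg'] with z h2z hgz
    rw [SmoothSection.sum_apply]
    simp only [SmoothSection.fmul_apply, hgz]
    exact (h2z (μ z)).symm
  have hdir : ∀ i, dirDeriv (g i) X = vectorDeriv (fun z => c z (μ z)) y X i := by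
    intro i
    have e1 := vectorDeriv_clm_comp (ContinuousLinearMap.proj (R := ℝ) (φ := fun _ : ι => ℝ) i)
      ((h1.self_of_nhds μ).mdifferentiableAt (by simp)) X
    exact (vectorDeriv_congr (hg' i) X).trans e1
  have e : D μ = ∑ i, vectorDeriv (fun z => c z (μ z)) y X i • s i y +
      ∑ i, c y (μ y) i • D (s i) := by
    rw [hμ, map_sum, ← Finset.sum_add_distrib]
    refine Finset.sum_congr rfl fun i _ => ?_
    rw [hD, hdir, (hg' i).self_of_nhds]
  rw [e, map_add, h3, map_sum]
  simp

end LocalFrames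

/-! ### Linear relations between sections of a bundle. -/

section SectionDichotomy

open Filter Topology

variable {E : Type*} [NormedAddCommGroup E] [NormedSpace ℝ E]
  {M : Type*} [TopologicalSpace M] [ChartedSpace E M] [IsManifold 𝓘(ℝ, E) ∞ M]
  {FF : Type*} [NormedAddCommGroup FF] [NormedSpace ℝ FF]
  {F : M → Type*} [TopologicalSpace (TotalSpace FF F)]
  [∀ x, AddCommGroup (F x)] [∀ x, Module ℝ (F x)] [∀ x, TopologicalSpace (F x)]
  [FiberBundle FF F] [VectorBundle ℝ FF F]
  [∀ x, IsTopologicalAddGroup (F x)] [∀ x, ContinuousSMul ℝ (F x)]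
  [FiniteDimensional ℝ E] [T2Space M] [ContMDiffVectorBundle ∞ FF F 𝓘(ℝ, E)]
  [FiniteDimensional ℝ FF]
  {κ ι ϖ : Type*} [Fintype κ] [Fintype ι] [Fintype ϖ]

/-- Consider sections `β i p` of `F`, and covariant differential operators `𝔇 j` whose symbols span
the tangent space, such that `𝔇 j (β i p) = ∑ C j i l β l p + ∑ Γ j p q β i q`. If `Γ j p o = 0` for
all `p`, then the `o`-th coefficient of the fibrewise linear relations between the columns of `β`
is near `y₀` either always zero, or equal to one for a smooth relation. -/
theorem relation_dichotomy {y₀ : M} (X : κ → SmoothSection E E (TangentSpace 𝓘(ℝ, E) (M := M)))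
    (hX : ⊤ ≤ Submodule.span ℝ (Set.range fun j => X j y₀))
    (𝔇 : κ → SmoothSection E FF F →ₗ[ℝ] SmoothSection E FF F)
    (h𝔇 : ∀ j (g : C^∞⟮𝓘(ℝ, E), M; ℝ⟯) μ y, 𝔇 j (SmoothSection.fmul g μ) y =
      dirDeriv g (X j y) • μ y + g y • 𝔇 j μ y)
    (β : ι → ϖ → SmoothSection E FF F) (o : ϖ)
    {C : κ → ι → ι → M → ℝ} {Γ : κ → ϖ → ϖ → M → ℝ}
    (hC : ∀ j i l, ContinuousAt (C j i l) y₀) (hΓ : ∀ j p q, ContinuousAt (Γ j p q) y₀)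
    (hΓo : ∀ᶠ y in 𝓝 y₀, ∀ j p, Γ j p o y = 0)
    (hβ : ∀ᶠ y in 𝓝 y₀, ∀ j i p, 𝔇 j (β i p) y =
      ∑ l, C j i l y • β l p y + ∑ q, Γ j p q y • β i q y) :
    (∀ᶠ y in 𝓝 y₀, ∀ k : ϖ → ℝ, (∀ i, ∑ p, k p • β i p y = 0) → k o = 0) ∨
      ∃ k : ϖ → C^∞⟮𝓘(ℝ, E), M; ℝ⟯,
        ∀ᶠ y in 𝓝 y₀, k o y = 1 ∧ ∀ i, ∑ p, k p y • β i p y = 0 := by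
  classical
  have : T2Space (F y₀) := FiberBundle.t2Space FF F y₀
  have : FiniteDimensional ℝ (F y₀) := VectorBundle.finiteDimensional ℝ FF F y₀
  obtain ⟨r, ⟨b⟩⟩ : ∃ r, Nonempty (Module.Basis (Fin r) ℝ (F y₀)) :=
    ⟨_, ⟨Module.finBasis ℝ (F y₀)⟩⟩
  choose f hf using fun q => SmoothSection.exists_eq (E := E) (FV := FF) (b q)
  have hf' : (fun q => f q y₀) = b := funext hf
  obtain ⟨c, hc, hli⟩ := SmoothSection.exists_isCoeffNear f y₀ (by rw [hf']; exact b.span_eq.ge)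
  replace hli := hli (by rw [hf']; exact b.linearIndependent)
  have hcinj : ∀ᶠ y in 𝓝 y₀, ∀ u : F y, c y u = 0 → u = 0 := by
    filter_upwards [hc.sum_smul] with y hy u hu
    rw [← hy u, hu]
    simp
  -- `B y` applies a vector of coefficients to the columns of `β` and reads the result in the frame
  -- `f`; near `y₀` its kernel is the space of relations at `y`.
  let B : M → (ϖ → ℝ) →L[ℝ] (ι → Fin r → ℝ) := fun y => ∑ p,
    ContinuousLinearMap.smulRightL ℝ (ϖ → ℝ) (ι → Fin r → ℝ) (ContinuousLinearMap.proj p)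
      (fun i => c y (β i p y))
  have hBapp : ∀ y k i, B y k i = c y (∑ p, k p • β i p y) := by
    intro y k i
    simp [B]
  have hB : ∀ᶠ y in 𝓝 y₀,
      ContMDiffAt 𝓘(ℝ, E) 𝓘(ℝ, (ϖ → ℝ) →L[ℝ] (ι → Fin r → ℝ)) ∞ B y := by
    filter_upwards [hc.contMDiffAt] with y hy
    refine ContMDiffAt.sum fun p _ => ?_
    exact (ContinuousLinearMap.contMDiff _).contMDiffAt.comp y
      (contMDiffAt_pi_space.2 fun i => hy (β i p))
  let Γ' : κ → M → (ϖ → ℝ) →L[ℝ] (ϖ → ℝ) := fun j y => ∑ p, ∑ q,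
    Γ j p q y • (ContinuousLinearMap.proj (R := ℝ) (φ := fun _ : ϖ => ℝ) p).smulRight
      (Pi.single q (1 : ℝ))
  have hΓ' : ∀ j y k q, Γ' j y k q = ∑ p, Γ j p q y * k p := by
    intro j y k q
    simp [Γ', Pi.single_apply]
  -- Besides `C`, the left coefficient contains the connection matrix of `𝔇 j` in the frame `f`. It
  -- enters with a minus sign, since differentiating coefficients differs from taking coefficients
  -- of `𝔇 j` by that matrix.
  let C' : κ → M → (ι → Fin r → ℝ) →L[ℝ] (ι → Fin r → ℝ) := fun j y => ∑ i,
    ((∑ l, C j i l y • (ContinuousLinearMap.single ℝ (fun _ : ι => Fin r → ℝ) i).comp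
        (ContinuousLinearMap.proj l)) -
      ∑ s, ContinuousLinearMap.smulRightL ℝ (ι → Fin r → ℝ) (ι → Fin r → ℝ)
        ((ContinuousLinearMap.proj (R := ℝ) (φ := fun _ : Fin r => ℝ) s).comp
          (ContinuousLinearMap.proj (R := ℝ) (φ := fun _ : ι => Fin r → ℝ) i))
        (Pi.single i (c y (𝔇 j (f s) y))))
  have hC' : ∀ j y w i, C' j y w i =
      ∑ l, C j i l y • w l - ∑ s, w i s • c y (𝔇 j (f s) y) := by
    intro j y w i
    simp only [C', sum_apply, sub_apply, Finset.sum_apply, Pi.sub_apply]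
    rw [Finset.sum_eq_single i]
    · congr 1
      · exact Finset.sum_congr rfl fun l _ => by simp
      · exact Finset.sum_congr rfl fun l _ => by simp
    · intro l _ hl
      simp [hl.symm]
    · simp
  have key := kernel_dichotomy_manifold (ContinuousLinearMap.proj o) hB X hX
    (Γ := Γ') (C := C') ?_ ?_ ?_ ?_
  · refine key.imp (fun h => ?_) ?_
    · filter_upwards [h] with y hy k hk
      refine hy k ?_
      ext i : 1
      rw [hBapp, hk i, map_zero]
      rfl
    · rintro ⟨k, hk, hk1⟩
      choose k' hk' using fun p => exists_contMDiffMap_eventuallyEq (g := fun y => k y p)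
        (hk.mono fun y hy => contMDiffAt_pi_space.1 hy p)
      refine ⟨k', ?_⟩
      filter_upwards [eventually_all.2 hk', hk1, hcinj] with y h1 h2 h3
      simp only [h1]
      exact ⟨h2.2, fun i => h3 _ (by rw [← hBapp, h2.1]; rfl)⟩
  · intro j
    simp only [Γ']
    fun_prop
  · intro j
    have hcs : ∀ s, ContinuousAt (fun y => c y (𝔇 j (f s) y)) y₀ := fun s =>
      (hc.contMDiffAt.self_of_nhds (𝔇 j (f s))).continuousAt
    refine tendsto_finsetSum _ fun i _ => Tendsto.sub (tendsto_finsetSum _ fun l _ => ?_)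
      (tendsto_finsetSum _ fun s _ => ?_)
    · exact (hC j i l).smul continuousAt_const
    · refine (ContinuousLinearMap.continuous _).continuousAt.tendsto.comp ?_
      exact ((continuous_single i).continuousAt).tendsto.comp (hcs s)
  · filter_upwards [hΓo] with y hy j k
    change Γ' j y k o = 0
    simp [hΓ', hy]
  · filter_upwards [hc.vectorDeriv_eq hli, hβ, hB] with y h1 h2 h3 j k
    ext i : 1
    have e1 := vectorDeriv_clm_comp
      (ContinuousLinearMap.proj (R := ℝ) (φ := fun _ : ι => Fin r → ℝ) i)
      ((h3.clm_apply (contMDiffAt_const (c := k))).mdifferentiableAt (by simp)) (X j y)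
    have e2 : (fun z => B z k i) = fun z => c z ((∑ p, k p • β i p) z) := by
      funext z
      rw [hBapp, SmoothSection.sum_apply]
      rfl
    have e3 := h1 (X j y)
      { toFun := fun μ => 𝔇 j μ y, map_add' := fun μ ν => by simp, map_smul' := fun r μ => by simp }
      (fun g μ => h𝔇 j g μ y) (∑ p, k p • β i p)
    have e4 : 𝔇 j (∑ p, k p • β i p) y = ∑ p, k p • 𝔇 j (β i p) y := by
      rw [map_sum, SmoothSection.sum_apply]
      exact Finset.sum_congr rfl fun p _ => by rw [map_smul]; rfl
    have e5 : (∑ p, k p • β i p) y = ∑ p, k p • β i p y := by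
      rw [SmoothSection.sum_apply]
      rfl
    change vectorDeriv (fun z => B z k) y (X j y) i = _
    refine e1.symm.trans ?_
    change vectorDeriv (fun z => B z k i) y (X j y) = _
    rw [e2, e3]
    change c y (𝔇 j (∑ p, k p • β i p) y) - ∑ s, c y ((∑ p, k p • β i p) y) s •
      c y (𝔇 j (f s) y) = B y (Γ' j y k) i + C' j y (B y k) i
    rw [e4, hC', hBapp y (Γ' j y k), e5, hBapp y k i]
    simp only [h2, hΓ', hBapp y k, smul_add, Finset.sum_add_distrib, map_add, ← add_sub_assoc]
    congr 1
    rw [add_comm]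
    simp only [map_sum, map_smul, Finset.smul_sum, smul_smul, Finset.sum_smul]
    congr 1
    · rw [Finset.sum_comm]
      exact Finset.sum_congr rfl fun q _ => Finset.sum_congr rfl fun p _ => by rw [mul_comm]
    · rw [Finset.sum_comm]
      exact Finset.sum_congr rfl fun q _ => Finset.sum_congr rfl fun p _ => by rw [mul_comm]

end SectionDichotomy

/-! ### Propagation of isotropy conditions over a connected base. -/

section Propagation

open Filter Topology

/-- A property which near every point holds either always or never is constant on a connected
space. -/
theorem forall_of_eventually_not_or_eventually {X : Type*} [TopologicalSpace X]
    [PreconnectedSpace X] {p : X → Prop} (h : ∀ x, (∀ᶠ y in 𝓝 x, ¬ p y) ∨ ∀ᶠ y in 𝓝 x, p y)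
    {x : X} (hx : p x) (y : X) : p y := by
  have hc : IsClopen {y | p y} := by
    refine ⟨⟨isOpen_iff_mem_nhds.2 fun y hy => ?_⟩, isOpen_iff_mem_nhds.2 fun y hy => ?_⟩
    · exact (h y).resolve_right fun h' => hy h'.self_of_nhds
    · exact (h y).resolve_left fun h' => h'.self_of_nhds hy
  have : y ∈ {y | p y} := by
    rw [hc.eq_univ ⟨x, hx⟩]
    trivial
  exact this

variable {E : Type*} [NormedAddCommGroup E] [NormedSpace ℝ E] [FiniteDimensional ℝ E]
  {M : Type*} [TopologicalSpace M] [ChartedSpace E M] [IsManifold 𝓘(ℝ, E) ∞ M] [T2Space M]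
  {FA : Type*} [NormedAddCommGroup FA] [NormedSpace ℝ FA] [FiniteDimensional ℝ FA]
  {A : M → Type*} [TopologicalSpace (TotalSpace FA A)]
  [∀ x, AddCommGroup (A x)] [∀ x, Module ℝ (A x)] [∀ x, TopologicalSpace (A x)]
  [∀ x, IsTopologicalAddGroup (A x)] [∀ x, ContinuousSMul ℝ (A x)]
  [FiberBundle FA A] [VectorBundle ℝ FA A] [ContMDiffVectorBundle ∞ FA A 𝓘(ℝ, E)]
  {FF : Type*} [NormedAddCommGroup FF] [NormedSpace ℝ FF] [FiniteDimensional ℝ FF]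
  {F : M → Type*} [TopologicalSpace (TotalSpace FF F)]
  [∀ x, AddCommGroup (F x)] [∀ x, Module ℝ (F x)] [∀ x, TopologicalSpace (F x)]
  [∀ x, IsTopologicalAddGroup (F x)] [∀ x, ContinuousSMul ℝ (F x)]
  [FiberBundle FF F] [VectorBundle ℝ FF F] [ContMDiffVectorBundle ∞ FF F 𝓘(ℝ, E)]

namespace LieAlgebroid

/-- The sections of the adjoint bundle form an ideal of `Γ(A)`. -/
theorem bracket_mem_adjointFiber_of_forall (𝒜 : LieAlgebroid E FA A) (a : SmoothSection E FA A)
    {w : SmoothSection E FA A} (hw : ∀ y, w y ∈ 𝒜.adjointFiber y) (y : M) :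
    𝒜.bracket a w y ∈ 𝒜.adjointFiber y := by
  rw [mem_adjointFiber, 𝒜.anchor_bracket]
  have : (fun y => 𝒜.anchor y (w y)) = 0 := funext fun y => 𝒜.mem_adjointFiber.1 (hw y)
  rw [this, VectorField.mlieBracket_zero_right]
  rfl

/-- The vector field `ρ(a)`. -/
noncomputable def anchorSection (𝒜 : LieAlgebroid E FA A) (a : SmoothSection E FA A) :
    SmoothSection E E (TangentSpace 𝓘(ℝ, E) (M := M)) :=
  ⟨fun x => 𝒜.anchor x (a x), 𝒜.anchor.contMDiff.clm_bundle_apply a.contMDiff⟩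

/-- Local frames adapted to the anchor of a transitive Lie algebroid. -/
theorem exists_adapted_sections (𝒜 : LieAlgebroid E FA A) (h𝒜 : 𝒜.IsTransitive) (y₀ : M) :
    ∃ (n d : ℕ) (w : Fin n → SmoothSection E FA A) (a : Fin d → SmoothSection E FA A)
      (c : ∀ y, A y →ₗ[ℝ] (Fin n → ℝ)),
      (∀ i y, w i y ∈ 𝒜.adjointFiber y) ∧
      ⊤ ≤ Submodule.span ℝ (Set.range fun j => 𝒜.anchorSection (a j) y₀) ∧
      (∀ t : SmoothSection E FA A, ContinuousAt (fun y => c y (t y)) y₀) ∧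
      ∀ᶠ y in 𝓝 y₀, ∀ u ∈ 𝒜.adjointFiber y, ∑ i, c y u i • w i y = u := by
  have : T2Space (A y₀) := FiberBundle.t2Space FA A y₀
  have : FiniteDimensional ℝ (A y₀) := VectorBundle.finiteDimensional ℝ FA A y₀
  obtain ⟨n, ⟨b⟩⟩ : ∃ n, Nonempty (Module.Basis (Fin n) ℝ (𝒜.adjointFiber y₀)) :=
    ⟨_, ⟨Module.finBasis ℝ _⟩⟩
  have : FiniteDimensional ℝ (TangentSpace 𝓘(ℝ, E) y₀) := inferInstanceAs (FiniteDimensional ℝ E)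
  obtain ⟨d, ⟨bT⟩⟩ : ∃ d, Nonempty (Module.Basis (Fin d) ℝ (TangentSpace 𝓘(ℝ, E) y₀)) :=
    ⟨_, ⟨Module.finBasis ℝ _⟩⟩
  choose w hw hwb using fun i => 𝒜.exists_adjoint_section h𝒜 (b i).2
  choose v hv using fun j => h𝒜 y₀ (bT j)
  choose a ha using fun j => SmoothSection.exists_eq (E := E) (FV := FA) (v j)
  have haT : (fun j => 𝒜.anchorSection (a j) y₀) = bT := by
    funext j
    rw [← hv j, ← ha j]
    rfl
  have hspan : ⊤ ≤ Submodule.span ℝ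
      (Set.range fun i : Fin n ⊕ Fin d => (Sum.elim w a i : SmoothSection E FA A) y₀) := by
    intro u _
    have hL : u - ∑ j, bT.repr (𝒜.anchor y₀ u) j • a j y₀ ∈ 𝒜.adjointFiber y₀ := by
      rw [mem_adjointFiber, map_sub, map_sum]
      simp only [map_smul, ha, hv]
      rw [bT.sum_repr, sub_self]
    have e := congrArg Subtype.val (b.sum_repr ⟨_, hL⟩)
    rw [Submodule.coe_sum] at e
    rw [← sub_add_cancel u (∑ j, bT.repr (𝒜.anchor y₀ u) j • a j y₀)]
    refine Submodule.add_mem _ ?_ (Submodule.sum_mem _ fun j _ => Submodule.smul_mem _ _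
      (Submodule.subset_span ⟨Sum.inr j, rfl⟩))
    rw [← show _ = u - ∑ j, bT.repr (𝒜.anchor y₀ u) j • a j y₀ from e]
    refine Submodule.sum_mem _ fun i _ => Submodule.smul_mem _ _ ?_
    rw [← hwb i]
    exact Submodule.subset_span ⟨Sum.inl i, rfl⟩
  have hspanT : ⊤ ≤ Submodule.span ℝ (Set.range fun j => 𝒜.anchorSection (a j) y₀) := by
    rw [haT, bT.span_eq]
  obtain ⟨c, hc, -⟩ := SmoothSection.exists_isCoeffNear (Sum.elim w a) y₀ hspan
  obtain ⟨cT, -, hT⟩ := SmoothSection.exists_isCoeffNear (fun j => 𝒜.anchorSection (a j)) y₀ hspanT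
  replace hT := hT (by rw [haT]; exact bT.linearIndependent)
  -- Only the coefficients of the `w i` are kept. For `u` in the adjoint bundle the others vanish:
  -- the anchor kills `u` and the `w i`, and the fields `ρ(a j)` stay independent near `y₀`.
  refine ⟨n, d, w, a, fun y => LinearMap.funLeft ℝ ℝ Sum.inl ∘ₗ c y, hw, hspanT, fun t => ?_, ?_⟩
  · have := (hc.contMDiffAt.self_of_nhds t).continuousAt
    exact continuousAt_pi.2 fun i => continuousAt_pi.1 this (Sum.inl i)
  · filter_upwards [hc.sum_smul, hT] with y h1 h2 u hu
    have e := h1 u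
    rw [Fintype.sum_sum_type] at e
    simp only [Sum.elim_inl, Sum.elim_inr] at e
    have e0 : ∑ j, c y u (Sum.inr j) • 𝒜.anchorSection (a j) y = 0 := by
      have e' := congrArg (𝒜.anchor y) e
      rw [map_add, map_sum, map_sum, 𝒜.mem_adjointFiber.1 hu, Finset.sum_eq_zero, zero_add] at e'
      · simp only [map_smul] at e'
        exact e'
      · intro i _
        rw [map_smul, 𝒜.mem_adjointFiber.1 (hw i y), smul_zero]
    have h3 := h2 fun j => c y u (Sum.inr j)
    rw [e0, map_zero] at h3
    rw [Finset.sum_eq_zero (s := Finset.univ (α := Fin d)) fun j _ => by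
      rw [← congrFun h3 j]; simp, add_zero] at e
    exact e

namespace Representation

variable {𝒜 : LieAlgebroid E FA A} (𝔏 : 𝒜.Representation FF F)

/-- The operator `μ ↦ 𝔏_a μ` on sections. -/
noncomputable def actLinear (a : SmoothSection E FA A) : SmoothSection E FF F →ₗ[ℝ] SmoothSection E FF F where
  toFun := 𝔏.act a
  map_add' μ ν := by ext y; exact map_add (𝔏.toFun y (a y)) μ ν
  map_smul' r μ := by ext y; exact map_smul (𝔏.toFun y (a y)) r μ

theorem actLinear_fmul (a : SmoothSection E FA A) (g : C^∞⟮𝓘(ℝ, E), M; ℝ⟯)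
    (μ : SmoothSection E FF F) (y : M) : 𝔏.actLinear a (SmoothSection.fmul g μ) y =
      dirDeriv g (𝒜.anchorSection a y) • μ y + g y • 𝔏.actLinear a μ y :=
  𝔏.isCovariantDiffOp y (a y) g μ

/-- The cocycle identity in the form of a differential equation for `Ω(w)`, used with `w` in the
adjoint bundle, where the last term is algebraic in `Ω(a)`. -/
theorem act_onSection {Ω : AlgebroidCochain E FA A FF F} (hΩ : Ω ∈ 𝔏.D1)
    (a w : SmoothSection E FA A) (y : M) : 𝔏.actLinear a (Ω.onSection w) y =
      Ω y (𝒜.bracket a w y) + 𝔏.toFun y (w y) (Ω.onSection a) := by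
  have h := congrArg (fun s : SmoothSection E FF F => s y) (hΩ a w)
  simp only [ContMDiffSection.coe_sub, Pi.sub_apply] at h
  exact sub_eq_iff_eq_add.1 h.symm

/-- The restriction of a cocycle to the isotropy algebras is, near each point, either everywhere or
nowhere a coboundary; in the first case there is a smooth primitive. -/
theorem eventually_not_or_exists_primitive (h𝒜 : 𝒜.IsTransitive)
    {Ω : AlgebroidCochain E FA A FF F} (hΩ : Ω ∈ 𝔏.D1) (y₀ : M) :
    (∀ᶠ y in 𝓝 y₀, ¬ ∃ μ : SmoothSection E FF F, ∀ u ∈ 𝒜.adjointFiber y,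
      Ω y u = 𝔏.toFun y u μ) ∨
    ∃ μ : SmoothSection E FF F, ∀ᶠ y in 𝓝 y₀, ∀ u ∈ 𝒜.adjointFiber y,
      Ω y u = 𝔏.toFun y u μ := by
  obtain ⟨n, d, w, a, c, hw, ha, hcs, hc⟩ := 𝒜.exists_adapted_sections h𝒜 y₀
  have : T2Space (F y₀) := FiberBundle.t2Space FF F y₀
  have : FiniteDimensional ℝ (F y₀) := VectorBundle.finiteDimensional ℝ FF F y₀
  obtain ⟨r, ⟨b⟩⟩ : ∃ r, Nonempty (Module.Basis (Fin r) ℝ (F y₀)) := ⟨_, ⟨Module.finBasis ℝ _⟩⟩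
  choose f hf using fun q => SmoothSection.exists_eq (E := E) (FV := FF) (b q)
  obtain ⟨cF, hcF, -⟩ := SmoothSection.exists_isCoeffNear f y₀
    (by rw [show (fun q => f q y₀) = b from funext hf]; exact b.span_eq.ge)
  have expand : ∀ᶠ y in 𝓝 y₀, ∀ i (μ : SmoothSection E FF F),
      𝔏.toFun y (w i y) μ = ∑ q, cF y (μ y) q • 𝔏.toFun y (w i y) (f q) := by
    filter_upwards [hcF.sum_smul] with y hy i μ
    rw [𝔏.toFun_congr (hw i y) (μ' := ∑ q, cF y (μ y) q • f q), map_sum]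
    · simp only [map_smul]
    · rw [SmoothSection.sum_apply]
      exact (hy (μ y)).symm
  -- Column `none` carries the cocycle and column `some q` the action on `f q`. The coefficient of
  -- `Γ` at target `none` is zero because, apart from the bracket terms collected in `C`, every term
  -- is an action of `w i` on a section of `F` and expands in the columns `some q`.
  let β : Fin n → Option (Fin r) → SmoothSection E FF F := fun i p =>
    p.elim (Ω.onSection (w i)) fun q => 𝔏.actLinear (w i) (f q)
  let Γ : Fin d → Option (Fin r) → Option (Fin r) → M → ℝ := fun j p q y =>
    q.elim 0 fun q => cF y (p.elim (Ω.onSection (a j) y) fun p => 𝔏.actLinear (a j) (f p) y) q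
  have key := relation_dichotomy (fun j => 𝒜.anchorSection (a j)) ha
    (fun j => 𝔏.actLinear (a j)) (fun j => 𝔏.actLinear_fmul (a j)) β none
    (C := fun j i l y => c y (𝒜.bracket (a j) (w i) y) l) (Γ := Γ)
    (fun j i l => continuousAt_pi.1 (hcs _) l) ?_ (Eventually.of_forall fun y j p => rfl) ?_
  · refine key.imp (fun h => ?_) ?_
    · filter_upwards [h, expand] with y hy hex
      rintro ⟨μ, hμ⟩
      -- A primitive at `y` is a relation with coefficient 1 at `none` and minus the coordinates of
      -- its value elsewhere, which the first alternative excludes.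
      refine zero_ne_one (hy (fun p => p.elim 1 fun q => - cF y (μ y) q) fun i => ?_).symm
      rw [Fintype.sum_option]
      change (1 : ℝ) • Ω y (w i y) + ∑ q, (- cF y (μ y) q) • 𝔏.toFun y (w i y) (f q) = 0
      rw [hμ _ (hw i y), hex i μ]
      simp
    · rintro ⟨k, hk⟩
      refine ⟨- ∑ q, SmoothSection.fmul (k (some q)) (f q), ?_⟩
      filter_upwards [hk, hc] with y ⟨hk1, hk0⟩ hcy u hu
      have hwi : ∀ i, Ω y (w i y) =
          𝔏.toFun y (w i y) (- ∑ q, SmoothSection.fmul (k (some q)) (f q)) := by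
        intro i
        have e := hk0 i
        rw [Fintype.sum_option, hk1, one_smul] at e
        rw [map_neg, map_sum, eq_neg_iff_add_eq_zero, ← e]
        congr 1
        refine Finset.sum_congr rfl fun q _ => ?_
        rw [𝔏.isCovariantDiffOp, 𝒜.mem_adjointFiber.1 (hw i y), dirDeriv_zero, zero_smul, zero_add]
        rfl
      rw [← hcy u hu]
      simp only [map_sum, map_smul, LinearMap.sum_apply, LinearMap.smul_apply, hwi]
  · intro j p q
    cases q with
    | none => exact continuousAt_const
    | some q =>
      cases p with
      | none => exact continuousAt_pi.1 (hcF.contMDiffAt.self_of_nhds _).continuousAt q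
      | some p => exact continuousAt_pi.1 (hcF.contMDiffAt.self_of_nhds _).continuousAt q
  · filter_upwards [hc, expand] with y hcy hex j i p
    have hbr := hcy _ (𝒜.bracket_mem_adjointFiber_of_forall (a j) (hw i) y)
    rw [Fintype.sum_option]
    change _ = _ + ((0 : ℝ) • _ + _)
    rw [zero_smul, zero_add]
    cases p with
    | none =>
      refine (𝔏.act_onSection hΩ (a j) (w i) y).trans ?_
      have e : Ω y (𝒜.bracket (a j) (w i) y) =
          ∑ l, c y (𝒜.bracket (a j) (w i) y) l • Ω y (w l y) := by
        conv_lhs => rw [← hbr]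
        simp only [map_sum, map_smul]
      rw [hex i, e]
      rfl
    | some p =>
      have e := 𝔏.map_bracket (a j) (w i) (f p) y
      change 𝔏.toFun y (a j y) (𝔏.act (w i) (f p)) = _
      refine (sub_eq_iff_eq_add.1 e.symm).trans ?_
      rw [hex i ⟨_, _⟩]
      congr 1
      conv_lhs => rw [← hbr]
      simp only [map_sum, map_smul, LinearMap.sum_apply, LinearMap.smul_apply]
      rfl

/-- The restriction of a cocycle with values in `F₀` to the isotropy algebras is, near each point,
either everywhere or nowhere zero. -/
theorem eventually_not_or_eventually_restrict_eq_zero (h𝒜 : 𝒜.IsTransitive)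
    {Ω : AlgebroidCochain E FA A FF F} (hΩ : Ω ∈ 𝔏.D1₀) (y₀ : M) :
    (∀ᶠ y in 𝓝 y₀, ¬ ∀ u ∈ 𝒜.adjointFiber y, Ω y u = 0) ∨
      ∀ᶠ y in 𝓝 y₀, ∀ u ∈ 𝒜.adjointFiber y, Ω y u = 0 := by
  obtain ⟨n, d, w, a, c, hw, ha, hcs, hc⟩ := 𝒜.exists_adapted_sections h𝒜 y₀
  have key := relation_dichotomy (fun j => 𝒜.anchorSection (a j)) ha
    (fun j => 𝔏.actLinear (a j)) (fun j => 𝔏.actLinear_fmul (a j))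
    -- With a single column, a nonzero relation means that all `Ω (w i)` vanish. Here `Γ = 0`,
    -- because `𝔏_{w i}` kills the `F₀`-valued section `Ω (a j)`.
    (fun i (_ : Unit) => Ω.onSection (w i)) ()
    (C := fun j i l y => c y (𝒜.bracket (a j) (w i) y) l) (Γ := fun _ _ _ _ => 0)
    (fun j i l => continuousAt_pi.1 (hcs _) l) (fun _ _ _ => continuousAt_const)
    (Eventually.of_forall fun y j p => rfl) ?_
  · refine key.imp (fun h => ?_) ?_
    · filter_upwards [h] with y hy hΩy
      refine zero_ne_one (hy (fun _ => 1) fun i => ?_).symm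
      simp [hΩy _ (hw i y)]
    · rintro ⟨k, hk⟩
      filter_upwards [hk, hc] with y ⟨hk1, hk0⟩ hcy u hu
      rw [← hcy u hu, map_sum]
      refine Finset.sum_eq_zero fun i _ => ?_
      have e := hk0 i
      rw [Fintype.sum_unique] at e
      change k () y • Ω y (w i y) = 0 at e
      rw [hk1, one_smul] at e
      rw [map_smul, e, smul_zero]
  · filter_upwards [hc] with y hcy j i _
    have hbr := hcy _ (𝒜.bracket_mem_adjointFiber_of_forall (a j) (hw i) y)
    have h0 := (𝔏.mem_F₀ (x := y) (μ := Ω.onSection (a j))).1 (hΩ.2 y (a j y)) _ (hw i y)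
    refine (𝔏.act_onSection hΩ.1 (a j) (w i) y).trans ?_
    rw [h0]
    conv_lhs => rw [← hbr]
    simp

variable [SigmaCompactSpace M] [ConnectedSpace M]

/-- A cocycle whose restriction to one isotropy algebra is a coboundary agrees on all isotropy
algebras with the coboundary of a global section. -/
theorem exists_global_primitive (h𝒜 : 𝒜.IsTransitive) {Ω : AlgebroidCochain E FA A FF F}
    (hΩ : Ω ∈ 𝔏.D1) {x : M} {μ₀ : SmoothSection E FF F}
    (hx : ∀ u ∈ 𝒜.adjointFiber x, Ω x u = 𝔏.toFun x u μ₀) :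
    ∃ μ : SmoothSection E FF F, ∀ y, ∀ u ∈ 𝒜.adjointFiber y, Ω y u = 𝔏.toFun y u μ := by
  have hall := forall_of_eventually_not_or_eventually
    (p := fun y => ∃ μ : SmoothSection E FF F, ∀ u ∈ 𝒜.adjointFiber y, Ω y u = 𝔏.toFun y u μ)
    (fun y => (𝔏.eventually_not_or_exists_primitive h𝒜 hΩ y).imp_right
      fun ⟨μ, hμ⟩ => hμ.mono fun z hz => ⟨μ, hz⟩) ⟨μ₀, hx⟩
  let t : ∀ y, Set (F y) := fun y =>
    {m | ∀ u : 𝒜.adjointFiber y, ⁅u, 𝔏.toFiber y m⁆ = 𝔏.toFiber y (Ω y u)}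
  -- The primitives at `y` solve an inhomogeneous linear system, so local smooth primitives can be
  -- averaged by a partition of unity.
  have ht : ∀ y, Convex ℝ (t y) := by
    intro y m hm m' hm' α β _ _ hαβ u
    rw [map_add, map_smul, map_smul, lie_add, lie_smul, lie_smul, hm u, hm' u, ← add_smul, hαβ,
      one_smul]
  obtain ⟨s, hs⟩ := exists_contMDiffSection_forall_mem_convex_of_local 𝓘(ℝ, E) (n := ⊤)
    (F_fiber := FF) F t ht fun y => by
      obtain ⟨μ, hμ⟩ := (𝔏.eventually_not_or_exists_primitive h𝒜 hΩ y).resolve_left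
        fun h => h.self_of_nhds (hall y)
      refine ⟨_, hμ, μ, μ.contMDiff.contMDiffOn, fun z hz u => ?_⟩
      rw [𝔏.lie_eq u μ, hz u u.2]
  refine ⟨s, fun y u hu => ?_⟩
  have h := hs y ⟨u, hu⟩
  rw [𝔏.lie_eq ⟨u, hu⟩ s] at h
  exact ((𝔏.toFiber y).injective h).symm

/-- A cocycle with values in `F₀` which vanishes on one isotropy algebra vanishes on all of them. -/
theorem restrict_eq_zero_of_restrict_eq_zero (h𝒜 : 𝒜.IsTransitive)
    {Ω : AlgebroidCochain E FA A FF F} (hΩ : Ω ∈ 𝔏.D1₀) {x : M}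
    (hx : ∀ u ∈ 𝒜.adjointFiber x, Ω x u = 0) (y : M) : ∀ u ∈ 𝒜.adjointFiber y, Ω y u = 0 :=
  forall_of_eventually_not_or_eventually (p := fun y => ∀ u ∈ 𝒜.adjointFiber y, Ω y u = 0)
    (𝔏.eventually_not_or_eventually_restrict_eq_zero h𝒜 hΩ) hx y

/-- A cocycle which vanishes on the adjoint bundle takes its values in `F₀`. -/
theorem mem_D1₀_of_restrict_eq_zero (h𝒜 : 𝒜.IsTransitive) {Ω : AlgebroidCochain E FA A FF F}
    (hΩ : Ω ∈ 𝔏.D1) (h : ∀ y, ∀ u ∈ 𝒜.adjointFiber y, Ω y u = 0) : Ω ∈ 𝔏.D1₀ := by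
  refine ⟨hΩ, fun y v => ?_⟩
  have hv : Ω y v = Ω.onSection (ext v) y := by simp
  rw [hv, mem_F₀]
  intro u hu
  obtain ⟨w, hw, rfl⟩ := 𝒜.exists_adjoint_section h𝒜 hu
  have e := 𝔏.act_onSection hΩ (ext v) w y
  have h0 : Ω.onSection w = 0 := by
    ext z
    exact h z _ (hw z)
  rw [h0, map_zero, h y _ (𝒜.bracket_mem_adjointFiber_of_forall _ hw y), zero_add] at e
  exact e.symm

end Representation

end LieAlgebroid

end Propagation

/-- The coboundaries with values in a trivial module vanish. -/
theorem lieOneCoboundary_eq_bot (𝔤 : Type*) [LieRing 𝔤] [LieAlgebra ℝ 𝔤]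
    (W : Type*) [AddCommGroup W] [Module ℝ W] [LieRingModule 𝔤 W] [LieModule ℝ 𝔤 W]
    [LieModule.IsTrivial 𝔤 W] : LieOneCoboundary 𝔤 W = ⊥ := by
  rw [LieOneCoboundary, LinearMap.range_eq_bot]
  ext w u
  simp [LieModule.IsTrivial.trivial]

/-! ### The kernels of the localization maps. -/

section Localization

variable {E : Type*} [NormedAddCommGroup E] [NormedSpace ℝ E] [FiniteDimensional ℝ E]
  {M : Type*} [TopologicalSpace M] [ChartedSpace E M] [IsManifold 𝓘(ℝ, E) ∞ M] [T2Space M]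
  {FA : Type*} [NormedAddCommGroup FA] [NormedSpace ℝ FA] [FiniteDimensional ℝ FA]
  {A : M → Type*} [TopologicalSpace (TotalSpace FA A)]
  [∀ x, AddCommGroup (A x)] [∀ x, Module ℝ (A x)] [∀ x, TopologicalSpace (A x)]
  [∀ x, IsTopologicalAddGroup (A x)] [∀ x, ContinuousSMul ℝ (A x)]
  [FiberBundle FA A] [VectorBundle ℝ FA A] [ContMDiffVectorBundle ∞ FA A 𝓘(ℝ, E)]
  {FF : Type*} [NormedAddCommGroup FF] [NormedSpace ℝ FF] [FiniteDimensional ℝ FF]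
  {F : M → Type*} [TopologicalSpace (TotalSpace FF F)]
  [∀ x, AddCommGroup (F x)] [∀ x, Module ℝ (F x)] [∀ x, TopologicalSpace (F x)]
  [∀ x, IsTopologicalAddGroup (F x)] [∀ x, ContinuousSMul ℝ (F x)]
  [FiberBundle FF F] [VectorBundle ℝ FF F] [ContMDiffVectorBundle ∞ FF F 𝓘(ℝ, E)]
  {𝒜 : LieAlgebroid E FA A} (𝔏 : 𝒜.Representation FF F)

namespace LieAlgebroid.Representation

/-- A trivial module has no nonzero coboundaries, so vanishing in cohomology means vanishing of the
restricted cocycle itself. -/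
theorem localization₀_proj₀_eq_zero_iff (x : M) (Ω : 𝔏.D1₀) :
    𝔏.localization₀ x (𝔏.proj₀ Ω) = 0 ↔ ∀ u ∈ 𝒜.adjointFiber x, Ω.1 x u = 0 := by
  change Submodule.Quotient.mk (𝔏.restrict₀ x Ω) = 0 ↔ _
  rw [Submodule.Quotient.mk_eq_zero, lieOneCoboundary_eq_bot, Submodule.submoduleOf,
    Submodule.mem_comap, Submodule.mem_bot]
  refine ⟨fun h u hu => ?_, fun h => ?_⟩
  · exact congrArg Subtype.val (LinearMap.congr_fun h ⟨u, hu⟩)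
  · ext u
    exact h u u.2

/-- Every vector of the fibre is the value of a smooth section, and `𝔏_u` for `u` in the isotropy
depends only on that value; so primitives in the fibre can be taken to be sections. -/
theorem localization_mk_eq_zero_iff (x : M) (Ω : 𝔏.D1) :
    𝔏.localization x (Submodule.Quotient.mk Ω) = 0 ↔
      ∃ μ : SmoothSection E FF F, ∀ u ∈ 𝒜.adjointFiber x, Ω.1 x u = 𝔏.toFun x u μ := by
  change Submodule.Quotient.mk (𝔏.restrict x Ω) = 0 ↔ _
  rw [Submodule.Quotient.mk_eq_zero]
  refine ⟨fun ⟨m, hm⟩ => ?_, fun ⟨μ, hμ⟩ => ?_⟩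
  · obtain ⟨μ, rfl⟩ := 𝔏.exists_section m
    refine ⟨μ, fun u hu => ?_⟩
    have := LinearMap.congr_fun hm ⟨u, hu⟩
    rw [lieD₀₁_apply, 𝔏.lie_eq ⟨u, hu⟩ μ] at this
    exact ((𝔏.toFiber x).injective this).symm
  · refine ⟨𝔏.toFiber x (μ x), LinearMap.ext fun u => ?_⟩
    rw [lieD₀₁_apply, 𝔏.lie_eq u μ, ← hμ u u.2]
    rfl

theorem localization_inclH1_eq_zero {x : M} {c : 𝔏.H1₀} (hc : 𝔏.localization₀ x c = 0) :
    𝔏.localization x (𝔏.inclH1 c) = 0 := by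
  obtain ⟨Ω, rfl⟩ := Submodule.mkQ_surjective _ c
  have h := (𝔏.localization₀_proj₀_eq_zero_iff x Ω).1 hc
  exact (𝔏.localization_mk_eq_zero_iff x ⟨Ω.1, Ω.2.1⟩).2 ⟨0, fun u hu => by rw [h u hu, map_zero]⟩

variable [SigmaCompactSpace M] [ConnectedSpace M]

/-- The representing cocycle vanishes on every isotropy algebra by propagation from `x`, which
forces any primitive in `F` to lie in `F₀`. -/
theorem eq_zero_of_inclH1_eq_zero (h𝒜 : 𝒜.IsTransitive) {x : M} {c : 𝔏.H1₀}
    (hc : 𝔏.localization₀ x c = 0) (h : 𝔏.inclH1 c = 0) : c = 0 := by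
  obtain ⟨Ω, rfl⟩ := Submodule.mkQ_surjective _ c
  have hx := (𝔏.localization₀_proj₀_eq_zero_iff x Ω).1 hc
  obtain ⟨μ, hμ⟩ := (Submodule.Quotient.mk_eq_zero _).1 h
  change 𝔏.d μ = Ω.1 at hμ
  refine (Submodule.Quotient.mk_eq_zero _).2 ⟨μ, fun y => 𝔏.mem_F₀.2 fun u hu => ?_, hμ⟩
  rw [← d_apply, hμ]
  exact 𝔏.restrict_eq_zero_of_restrict_eq_zero h𝒜 Ω.2 hx y u hu

/-- Subtracting the coboundary of a global primitive along the isotropy leaves the class unchanged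
and gives a cocycle that vanishes on the adjoint bundle, hence one with values in `F₀`. -/
theorem exists_inclH1_eq (h𝒜 : 𝒜.IsTransitive) {x : M} {c : 𝔏.H1}
    (hc : 𝔏.localization x c = 0) : ∃ c₀, 𝔏.localization₀ x c₀ = 0 ∧ 𝔏.inclH1 c₀ = c := by
  obtain ⟨Ω, rfl⟩ := Submodule.Quotient.mk_surjective _ c
  obtain ⟨μ₀, hμ₀⟩ := (𝔏.localization_mk_eq_zero_iff x Ω).1 hc
  obtain ⟨μ, hμ⟩ := 𝔏.exists_global_primitive h𝒜 Ω.2 hμ₀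
  have h0 : ∀ y, ∀ u ∈ 𝒜.adjointFiber y, (Ω.1 - 𝔏.d μ) y u = 0 := by
    intro y u hu
    change Ω.1 y u - 𝔏.d μ y u = 0
    rw [d_apply, hμ y u hu, sub_self]
  have h1 : Ω.1 - 𝔏.d μ ∈ 𝔏.D1₀ := 𝔏.mem_D1₀_of_restrict_eq_zero h𝒜
    (𝔏.D1.sub_mem Ω.2 (𝔏.B1_le_D1 ⟨μ, rfl⟩)) h0
  refine ⟨𝔏.proj₀ ⟨_, h1⟩, (𝔏.localization₀_proj₀_eq_zero_iff x _).2 (h0 x), ?_⟩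
  refine (Submodule.Quotient.eq _).2 ⟨- μ, ?_⟩
  rw [map_neg]
  change - 𝔏.d μ = Ω.1 - 𝔏.d μ - Ω.1
  abel

end LieAlgebroid.Representation

end Localization

theorem mainTheorem4
    {E : Type*} [NormedAddCommGroup E] [NormedSpace ℝ E] [FiniteDimensional ℝ E]
    -- a connected smooth manifold `M` modelled on `E`
    {M : Type*} [TopologicalSpace M] [ChartedSpace E M] [IsManifold 𝓘(ℝ, E) ∞ M]
    [T2Space M] [SigmaCompactSpace M] [ConnectedSpace M]
    -- a smooth real vector bundle `A → M` of finite rank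
    {FA : Type*} [NormedAddCommGroup FA] [NormedSpace ℝ FA] [FiniteDimensional ℝ FA]
    {A : M → Type*} [TopologicalSpace (TotalSpace FA A)]
    [∀ x, AddCommGroup (A x)] [∀ x, Module ℝ (A x)] [∀ x, TopologicalSpace (A x)]
    [∀ x, IsTopologicalAddGroup (A x)] [∀ x, ContinuousSMul ℝ (A x)]
    [FiberBundle FA A] [VectorBundle ℝ FA A] [ContMDiffVectorBundle ∞ FA A 𝓘(ℝ, E)]
    -- a smooth real vector bundle `F → M` of finite rank
    {FF : Type*} [NormedAddCommGroup FF] [NormedSpace ℝ FF] [FiniteDimensional ℝ FF]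
    {F : M → Type*} [TopologicalSpace (TotalSpace FF F)]
    [∀ x, AddCommGroup (F x)] [∀ x, Module ℝ (F x)] [∀ x, TopologicalSpace (F x)]
    [∀ x, IsTopologicalAddGroup (F x)] [∀ x, ContinuousSMul ℝ (F x)]
    [FiberBundle FF F] [VectorBundle ℝ FF F] [ContMDiffVectorBundle ∞ FF F 𝓘(ℝ, E)]
    -- a transitive Lie algebroid structure on `A`, a representation on `F`, and a point
    (𝒜 : LieAlgebroid E FA A) (h𝒜 : 𝒜.IsTransitive) (𝔏 : 𝒜.Representation FF F) (x : M) :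
    -- `H¹(L_x, F_{0x}) = D¹(L_x, F_{0x})`: the action of `L_x` on `F_{0x}` is trivial, and
    -- the projection `D¹ → H¹` is bijective
    (LieModule.IsTrivial (𝒜.adjointFiber x) (𝔏.F₀ x) ∧
      Function.Bijective (LieH1.proj (𝒜.adjointFiber x) (𝔏.F₀ x))) ∧
    -- `i_*` restricts to an isomorphism `Ker Υ_{0x} ≅ Ker Υ_x`
    (∃ e : LinearMap.ker (𝔏.localization₀ x) ≃ₗ[ℝ] LinearMap.ker (𝔏.localization x),
      ∀ c, (e c : 𝔏.H1) = 𝔏.inclH1 c) ∧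
    -- `Ker Υ_{0x} = {[Ω] | Ω ∈ D¹(A, F₀), Ω|_{L_x} = 0}`
    (LinearMap.ker (𝔏.localization₀ x) : Set 𝔏.H1₀) =
      {c | ∃ Ω : 𝔏.D1₀, (∀ u ∈ 𝒜.adjointFiber x, Ω.1 x u = 0) ∧ 𝔏.proj₀ Ω = c} := by
  refine ⟨⟨inferInstance, ?_, Submodule.mkQ_surjective _⟩, ?_, ?_⟩
  · refine (injective_iff_map_eq_zero _).2 fun c hc => ?_
    have h := (Submodule.Quotient.mk_eq_zero _).1 hc
    rw [lieOneCoboundary_eq_bot] at h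
    exact Subtype.ext h
  · have hmem : ∀ c ∈ LinearMap.ker (𝔏.localization₀ x),
        𝔏.inclH1 c ∈ LinearMap.ker (𝔏.localization x) := fun c hc =>
      𝔏.localization_inclH1_eq_zero hc
    refine ⟨LinearEquiv.ofBijective (𝔏.inclH1.restrict hmem) ⟨?_, ?_⟩, fun c => rfl⟩
    · rw [← LinearMap.ker_eq_bot, LinearMap.ker_eq_bot']
      exact fun c hc => Subtype.ext
        (𝔏.eq_zero_of_inclH1_eq_zero h𝒜 c.2 (congrArg Subtype.val hc))
    · rintro ⟨c, hc⟩
      obtain ⟨c₀, h₀, rfl⟩ := 𝔏.exists_inclH1_eq h𝒜 hc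
      exact ⟨⟨c₀, h₀⟩, rfl⟩
  · ext c
    constructor
    · intro hc
      obtain ⟨Ω, rfl⟩ := Submodule.mkQ_surjective _ c
      exact ⟨Ω, (𝔏.localization₀_proj₀_eq_zero_iff x Ω).1 hc, rfl⟩
    · rintro ⟨Ω, hΩ, rfl⟩
      exact (𝔏.localization₀_proj₀_eq_zero_iff x Ω).2 hΩ
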